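/- \textbf{Setting.} Let $I$ be a compact topological space with a Borel probability measure $m$ such that $m(\{x\})=0$ for all $x\in I$; write $|S|=m(S)$. Let $\rho$ be a quasi-metric on $I$ ($\rho(x,x)=0$, $\rho(x,y)>0$ for $x\ne y$, $\rho$ is symmetric and $\rho(x,z)\le K(\rho(x,y)+\rho(y,z))$ for some constant $K\ge 1$) whose balls $B_\rho(x,r)=\{y:\rho(x,y)<r\}$, $r>0$, are open, and suppose that $m$ is doubling: there is $C$ with $0<m(B_\rho(x,r))<C\,m(B_\rho(x,r/2))<\infty$ for all $x\in I$, $r>0$. Let $$\beta(x,y)=\inf\{m(B): B \text{ is a } \rho\text{-ball containing } x \text{ and } y\}$$ be the Macías–Segovia quasi-metric, and let $A\ge 1$ satisfy $\beta(x,z)\le A(\beta(x,y)+\beta(y,z))$ for all $x,y,z$. Let $\gamma>0$ be such that $$d_\gamma(x,y)=\inf\Big\{\sum_{i=0}^{n-1}\beta(x_i,x_{i+1})^\gamma : x_i\in I,\ x_0=x,\ x_n=y\Big\}$$ is a metric and $\frac1C d_\gamma\le\beta^\gamma\le C d_\gamma$ for some $C>0$. \textbf{Grid.} Let $\mathcal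 P=(\mathcal P^k)_{k\ge 0}$ be a good grid: each $\mathcal P^k$ is a finite family of measurable sets of positive measure which is a partition of $I$ up to null sets; every $Q\in\mathcal P^{k+1}$ is contained in some $W\in\mathcal P^k$; $\bigcup_k\mathcal P^k$ generates the Borel $\sigma$-algebra up to null sets; and there are $\hat\lambda,\lambda\in(0,1)$ with $\hat\lambda\le|Q|/|W|\le\lambda$ whenever $Q\in\mathcal P^{k+1}$, $W\in\mathcal P^k$, $Q\subset W$. Suppose moreover that there are $c_1,C_2,c_3,C_4>0$, $\kappa\in(0,1)$, $\eta\in\mathbb R$ and points $z_Q\in Q$ ($Q\in\mathcal P^k$, $k\ge0$) such that for all $k\ge 1$, $Q\in\mathcal P^k$ and $t>0$ $$B_\beta(z_Q,c_1\kappa^k)\subset Q,\qquad \operatorname{diam}_\beta Q\le C_2\kappa^k,\qquad m\{x\in Q:\beta(x,I\setminus Q)\le c_3t\kappa^k\}\le C_4t^\eta|Q|,$$ where $\beta(x,\emptyset)=\infty$. Let $p\in[1,\infty)$, $q\in[1,\infty]$, $0<s<1/p$, $s<\gamma$ and $\eta>sp$. \textbf{Spaces.} The canonical Souza atom on $Q$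 is $|Q|^{s-1/p}1_Q$. A Han–Lu–Yang $\gamma$-block associated to $Q\in\mathcal P^k$ is a function $a_Q:I\to\mathbb C$ with $\operatorname{supp}a_Q\subset B_\beta(z_Q,3AC_2\kappa^k)$, $|a_Q|\le|Q|^{s-1/p}$ and $|a_Q(x)-a_Q(y)|\le|Q|^{s-1/p-\gamma}\beta(x,y)^\gamma$ for all $x,y\in I$. The space $\mathbb B^s_{p,q}(\mathcal P)$ (respectively $B_{HLY}(s,p,q)$) is the set of all complex-valued $f\in L^p(m)$ that can be written as $$f=\sum_{k\ge0}\sum_{Q\in\mathcal P^k}c_Qa_Q\ \text{ in } L^p,\qquad \sum_k\Big\|\sum_{Q\in\mathcal P^k}c_Qa_Q\Big\|_p<\infty,\qquad \Big(\sum_k\Big(\sum_{Q\in\mathcal P^k}|c_Q|^p\Big)^{q/p}\Big)^{1/q}<\infty,$$ where $c_Q\in\mathbb C$ and $a_Q$ is the canonical Souza atom on $Q$ (respectively some Han–Lu–Yang $\gamma$-block associated to $Q$); for $q=\infty$ the last expression is read as $\sup_k\big(\sum_{Q\in\mathcal P^k}|c_Q|^p\big)^{1/p}$. The norm of $f$ is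 the infimum of the last expression over all such representations of $f$. \textbf{Conclusion.} $B_{HLY}(s,p,q)=\mathbb B^s_{p,q}(\mathcal P)$, and the two norms are equivalent: there is $C>0$, independent of $f$, such that for every $f$ in this space $|f|_{B_{HLY}(s,p,q)}\le C|f|_{\mathbb B^s_{p,q}(\mathcal P)}$ and $|f|_{\mathbb B^s_{p,q}(\mathcal P)}\le C|f|_{B_{HLY}(s,p,q)}$. -/

import Mathlib

open MeasureTheory Filter Topology
open scoped ENNReal NNReal

/-! ### Quasi-metrics and homogeneous spaces -/

/-- `A` is a constant in the quasi-triangle inequality of `ρ`. -/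
def IsQuasiTriangleConst {I : Type*} (ρ : I → I → ℝ) (A : ℝ) : Prop :=
  1 ≤ A ∧ ∀ x y z, ρ x z ≤ A * (ρ x y + ρ y z)

/-- Quasi-metrics on a set `I`. -/
structure IsQuasiMetric {I : Type*} (ρ : I → I → ℝ) : Prop where
  self_eq_zero : ∀ x, ρ x x = 0
  pos_of_ne : ∀ x y, x ≠ y → 0 < ρ x y
  symm : ∀ x y, ρ x y = ρ y x
  exists_const : ∃ A, IsQuasiTriangleConst ρ A

/-- The quasi-ball of centre `x` and radius `r`. -/
def qBall {I : Type*} (ρ : I → I → ℝ) (x : I) (r : ℝ) : Set I :=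
  {y | ρ x y < r}

/-- A homogeneous space: a quasi-metric with a doubling Borel measure, all quasi-balls being open.
On a compact space the openness of the quasi-balls forces the topology to be the one defined
by `ρ`, since the latter is Hausdorff. -/
structure IsHomogeneousSpace {I : Type*} [TopologicalSpace I] [MeasurableSpace I]
    (ρ : I → I → ℝ) (m : Measure I) : Prop where
  quasiMetric : IsQuasiMetric ρ
  doubling : ∃ C : ℝ≥0, ∀ x r, 0 < r →
    0 < m (qBall ρ x r) ∧ m (qBall ρ x r) < C * m (qBall ρ x (r / 2)) ∧
      C * m (qBall ρ x (r / 2)) < ∞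
  isOpen_qBall : ∀ x r, 0 < r → IsOpen (qBall ρ x r)

/-- The Macías–Segovia quasi-metric: `β(x, y)` is the infimum of the measures of the `ρ`-balls
that contain both `x` and `y`. -/
noncomputable def msDist {I : Type*} [MeasurableSpace I] (ρ : I → I → ℝ) (m : Measure I)
    (x y : I) : ℝ :=
  sInf {v : ℝ | ∃ w r, 0 < r ∧ x ∈ qBall ρ w r ∧ y ∈ qBall ρ w r ∧ v = m.real (qBall ρ w r)}

/-- The chain distance `d_γ(x, y)`: the infimum of `∑ β(u i, u (i + 1)) ^ γ` over the finite chains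
that join `x` to `y`. -/
noncomputable def chainDist {I : Type*} (β : I → I → ℝ) (γ : ℝ) (x y : I) : ℝ :=
  sInf {v : ℝ | ∃ (n : ℕ) (u : ℕ → I), u 0 = x ∧ u n = y ∧
    v = ∑ i ∈ Finset.range n, β (u i) (u (i + 1)) ^ γ}

/-- The four axioms of a metric. -/
structure IsMetric {I : Type*} (d : I → I → ℝ) : Prop where
  self_eq_zero : ∀ x, d x x = 0
  pos_of_ne : ∀ x y, x ≠ y → 0 < d x y
  symm : ∀ x y, d x y = d y x
  triangle : ∀ x y z, d x z ≤ d x y + d y z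

/-- `γ > 0` is such that `d_γ` is a metric comparable with `β ^ γ`. -/
def IsMetricExponent {I : Type*} (β : I → I → ℝ) (γ : ℝ) : Prop :=
  0 < γ ∧ IsMetric (chainDist β γ) ∧
    ∃ C : ℝ, 0 < C ∧ ∀ x y, (1 / C) * chainDist β γ x y ≤ β x y ^ γ ∧
      β x y ^ γ ≤ C * chainDist β γ x y

/-! ### Good grids -/

/-- A good grid: nested finite partitions modulo null sets, by measurable sets of positive measure,
which together generate the `σ`-algebra modulo null sets, with ratios between the measures of
consecutive cells bounded away from `0` and `1`. -/
structure IsGoodGrid {I : Type*} [MeasurableSpace I] (m : Measure I)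
    (P : ℕ → Finset (Set I)) : Prop where
  measurableSet : ∀ k, ∀ Q ∈ P k, MeasurableSet Q
  pos : ∀ k, ∀ Q ∈ P k, 0 < m Q
  cover : ∀ k, m (⋃ Q ∈ P k, Q)ᶜ = 0
  aedisjoint : ∀ k, ∀ Q ∈ P k, ∀ W ∈ P k, Q ≠ W → m (Q ∩ W) = 0
  nested : ∀ k, ∀ Q ∈ P (k + 1), ∃ W ∈ P k, Q ⊆ W
  generates : ∀ S, MeasurableSet S →
    ∃ T, MeasurableSet[MeasurableSpace.generateFrom {Q | ∃ k, Q ∈ P k}] T ∧ S =ᵐ[m] T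
  ratio : ∃ l u : ℝ, 0 < l ∧ u < 1 ∧ ∀ k, ∀ Q ∈ P (k + 1), ∀ W ∈ P k, Q ⊆ W →
    l ≤ m.real Q / m.real W ∧ m.real Q / m.real W ≤ u

/-- The distance `α(x, S) ∈ [0, ∞]` from a point to a set, equal to `∞` if `S = ∅`. -/
noncomputable def setDist {I : Type*} (α : I → I → ℝ) (x : I) (S : Set I) : ℝ≥0∞ :=
  ⨅ y ∈ S, ENNReal.ofReal (α x y)

/-- The geometric conditions on the cells of a grid, for the quasi-metric `α`: with centres `z k Q`,
a cell `Q` of level `k ≥ 1` contains the ball of radius `c₁ κ ^ k`, has diameter at most `C₂ κ ^ k`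
and has a thin boundary layer, with exponent `η`. On the level `k = 0` the centre is just a point
of the cell. -/
structure HasRegularCells {I : Type*} [MeasurableSpace I] (α : I → I → ℝ) (m : Measure I)
    (P : ℕ → Finset (Set I)) (z : ℕ → Set I → I) (η c₁ C₂ c₃ C₄ κ : ℝ) : Prop where
  c₁_pos : 0 < c₁
  C₂_pos : 0 < C₂
  c₃_pos : 0 < c₃
  C₄_pos : 0 < C₄
  κ_pos : 0 < κ
  κ_lt_one : κ < 1
  center_mem : ∀ k, ∀ Q ∈ P k, z k Q ∈ Q
  ball_subset : ∀ k, 1 ≤ k → ∀ Q ∈ P k, qBall α (z k Q) (c₁ * κ ^ k) ⊆ Q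
  diam_le : ∀ k, 1 ≤ k → ∀ Q ∈ P k, ∀ x ∈ Q, ∀ y ∈ Q, α x y ≤ C₂ * κ ^ k
  boundary : ∀ k, 1 ≤ k → ∀ Q ∈ P k, ∀ t : ℝ, 0 < t →
    m {x | x ∈ Q ∧ setDist α x Qᶜ ≤ ENNReal.ofReal (c₃ * t * κ ^ k)}
      ≤ ENNReal.ofReal (C₄ * t ^ η) * m Q

/-! ### Atomic decompositions -/

/-- The `ℓ^q(ℓ^p)` norm `(∑ₖ (∑_{Q ∈ P k} |c_Q| ^ p) ^ (q / p)) ^ (1 / q)` of a family of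
coefficients, with the supremum over `k` if `q = ∞`. -/
noncomputable def coeffNorm {I : Type*} (P : ℕ → Finset (Set I)) (p : ℝ) (q : ℝ≥0∞)
    (c : ℕ → Set I → ℂ) : ℝ≥0∞ :=
  if q = ∞ then ⨆ k, (∑ Q ∈ P k, ‖c k Q‖ₑ ^ p) ^ (1 / p)
  else (∑' k, (∑ Q ∈ P k, ‖c k Q‖ₑ ^ p) ^ (q.toReal / p)) ^ (1 / q.toReal)

/-- `f = ∑ₖ ∑_{Q ∈ P k} c_Q a_Q` in `L^p`, where the series over `k` is absolutely convergent
in `L^p`. -/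
def IsAtomicSum {I : Type*} [MeasurableSpace I] (m : Measure I) (P : ℕ → Finset (Set I)) (p : ℝ)
    (a : ℕ → Set I → I → ℂ) (c : ℕ → Set I → ℂ) (f : I → ℂ) : Prop :=
  (∑' k, eLpNorm (fun x => ∑ Q ∈ P k, c k Q * a k Q x) (ENNReal.ofReal p) m < ∞) ∧
  Tendsto (fun n => eLpNorm
      (fun x => f x - ∑ k ∈ Finset.range n, ∑ Q ∈ P k, c k Q * a k Q x) (ENNReal.ofReal p) m)
    atTop (𝓝 0)

/-- The canonical `(s, p)`-Souza atom on `Q`: the function `|Q| ^ (s - 1 / p)` on `Q`, and `0`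
outside. -/
noncomputable def souzaAtom {I : Type*} [MeasurableSpace I] (m : Measure I) (s p : ℝ)
    (Q : Set I) : I → ℂ :=
  Q.indicator fun _ => ((m.real Q ^ (s - 1 / p) : ℝ) : ℂ)

/-- Coefficients of a representation of `f` by canonical Souza atoms. -/
def IsSouzaRep {I : Type*} [MeasurableSpace I] (m : Measure I) (P : ℕ → Finset (Set I))
    (s p : ℝ) (q : ℝ≥0∞) (c : ℕ → Set I → ℂ) (f : I → ℂ) : Prop :=
  IsAtomicSum m P p (fun _ Q => souzaAtom m s p Q) c f ∧ coeffNorm P p q c < ∞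

/-- The Besov space of the grid `P`, as a set of functions (in `L^p`, modulo null sets). -/
def souzaBesov {I : Type*} [MeasurableSpace I] (m : Measure I) (P : ℕ → Finset (Set I))
    (s p : ℝ) (q : ℝ≥0∞) : Set (I → ℂ) :=
  {f | MemLp f (ENNReal.ofReal p) m ∧ ∃ c, IsSouzaRep m P s p q c f}

/-- The norm of the Besov space of the grid `P`. -/
noncomputable def souzaBesovNorm {I : Type*} [MeasurableSpace I] (m : Measure I)
    (P : ℕ → Finset (Set I)) (s p : ℝ) (q : ℝ≥0∞) (f : I → ℂ) : ℝ≥0∞ :=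
  ⨅ (c : ℕ → Set I → ℂ) (_ : IsSouzaRep m P s p q c f), coeffNorm P p q c

/-- `a` is a Han–Lu–Yang `γ`-block associated to a cell `Q` with centre `w`, where `R` is the radius
of the ball that contains its (closed) support. -/
structure IsHLYBlock {I : Type*} [TopologicalSpace I] [MeasurableSpace I] (β : I → I → ℝ)
    (m : Measure I) (γ s p : ℝ) (Q : Set I) (w : I) (R : ℝ) (a : I → ℂ) : Prop where
  tsupport_subset : tsupport a ⊆ qBall β w R
  bound : ∀ x, ‖a x‖ ≤ m.real Q ^ (s - 1 / p)
  holder : ∀ x y, ‖a x - a y‖ ≤ m.real Q ^ (s - 1 / p - γ) * β x y ^ γ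

/-- A representation of `f` by Han–Lu–Yang blocks `a k Q` with coefficients `c k Q`, the block
`a k Q` being supported in the ball of centre `z k Q` and radius `3 A C₂ κ ^ k`. -/
def IsHLYRep {I : Type*} [TopologicalSpace I] [MeasurableSpace I] (β : I → I → ℝ)
    (m : Measure I) (P : ℕ → Finset (Set I)) (z : ℕ → Set I → I) (A C₂ κ γ s p : ℝ) (q : ℝ≥0∞)
    (a : ℕ → Set I → I → ℂ) (c : ℕ → Set I → ℂ) (f : I → ℂ) : Prop :=
  (∀ k, ∀ Q ∈ P k, IsHLYBlock β m γ s p Q (z k Q) (3 * A * C₂ * κ ^ k) (a k Q)) ∧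
  IsAtomicSum m P p a c f ∧ coeffNorm P p q c < ∞

/-- The Han–Lu–Yang Besov space, as a set of functions (in `L^p`, modulo null sets). -/
def hlyBesov {I : Type*} [TopologicalSpace I] [MeasurableSpace I] (β : I → I → ℝ)
    (m : Measure I) (P : ℕ → Finset (Set I)) (z : ℕ → Set I → I) (A C₂ κ γ s p : ℝ)
    (q : ℝ≥0∞) : Set (I → ℂ) :=
  {f | MemLp f (ENNReal.ofReal p) m ∧ ∃ a c, IsHLYRep β m P z A C₂ κ γ s p q a c f}

/-- The norm of the Han–Lu–Yang Besov space. -/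
noncomputable def hlyBesovNorm {I : Type*} [TopologicalSpace I] [MeasurableSpace I]
    (β : I → I → ℝ) (m : Measure I) (P : ℕ → Finset (Set I)) (z : ℕ → Set I → I)
    (A C₂ κ γ s p : ℝ) (q : ℝ≥0∞) (f : I → ℂ) : ℝ≥0∞ :=
  ⨅ (a : ℕ → Set I → I → ℂ) (c : ℕ → Set I → ℂ)
    (_ : IsHLYRep β m P z A C₂ κ γ s p q a c f), coeffNorm P p q c

/-! Both inclusions rest on one mechanism, `IsAtomicTransfer.exists_rep`. Suppose that each atom on
a cell `Q` of level `k` is a telescoping sum, over `j ≥ k`, of multiples of atoms of the other kind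
on cells `R` of level `j`. Let the multiples have size `≲ μ ^ (j - k)`, let each `Q` use `≲ ν ^ (j -
k)` cells `R`, and let each `R` be used by boundedly many `Q` of each level. Collecting the
coefficients on each `R`, a Schur estimate bounds the new level norms by a convolution of the old
ones with powers of `τ = μ * ν ^ (1 / p)`, and Young's inequality concludes as soon as `μ ^ p * ν <
1`. The regrouping is legitimate in `L^p` because the remainders left at level `N` are `O(θ ^ N)`
with `θ < 1`, uniformly in `k ≤ N` (`tendsto_eLpNorm_sub_sum_of_remainders`).

For the Macías–Segovia quasi-metric, balls of radius `r ≤ 1` have measure comparable to `r`. Hence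
cells of level `k` have measure comparable to `κ ^ k`, and every count of cells is a quotient of
measures.

From blocks to Souza atoms (`IsRegularGrid.exists_transfer_souza`): a block is approximated by its
values at the centres of the cells of level `j`. By the Hölder bound the increments, relative to the
height of an atom of level `j`, have size `κ ^ ((γ + 1/p - s)(j - k))`; they occupy `≲ κ ^ (-(j -
k))` cells. Then `μ ^ p * ν = κ ^ ((γ - s) p) < 1`.

From Souza atoms to blocks (`IsRegularGrid.exists_transfer_block`): the indicator of `Q` is
exhausted from inside by Lipschitz cutoffs of scale `κ ^ j`, and their increments are cut into
blocks by a partition of unity adapted to the cells of level `j`. The relative size is only `κ ^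
((1/p - s)(j - k))`, but the increments live in a boundary layer of `Q`, which by thinness contains
`≲ κ ^ ((η - 1)(j - k))` cells. Then `μ ^ p * ν = κ ^ (η - s p) < 1`. -/

/-! ### Discrete inequalities: bounded overlap, geometric convolution, coefficient norms -/

/-- Only the nonzero terms enter the power mean inequality, so the constant depends on the overlap
and not on the size of `s`. -/
theorem ENNReal.rpow_sum_le_of_card_support_le {ι : Type*} (s : Finset ι) (y : ι → ℝ≥0∞) {p : ℝ}
    (hp : 1 ≤ p) {N : ℝ≥0∞} (hN1 : 1 ≤ N)
    (hN : ((s.filter fun i => y i ≠ 0).card : ℝ≥0∞) ≤ N) :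
    (∑ i ∈ s, y i) ^ p ≤ N ^ p * ∑ i ∈ s, y i ^ p := by
  classical
  rw [← Finset.sum_filter_ne_zero (s := s) (f := y)]
  calc _ ≤ ((s.filter fun i => y i ≠ 0).card : ℝ≥0∞) ^ (p - 1) *
        ∑ i ∈ s with y i ≠ 0, y i ^ p := ENNReal.rpow_sum_le_const_mul_sum_rpow _ _ hp
    _ ≤ N ^ (p - 1) * ∑ i ∈ s, y i ^ p := by
        refine mul_le_mul' (ENNReal.rpow_le_rpow hN (by linarith)) ?_
        exact Finset.sum_le_sum_of_subset (Finset.filter_subset _ _)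
    _ ≤ _ := by
        refine mul_le_mul' (ENNReal.rpow_le_rpow_of_exponent_le hN1 (by linarith)) le_rfl

theorem eLpNorm_sum_mul_le_of_overlap {ι I : Type*} [MeasurableSpace I] {m : Measure I}
    (s : Finset ι) (c : ι → ℂ) (F : ι → I → ℂ)
    (hF : ∀ i ∈ s, AEStronglyMeasurable (F i) m) {p : ℝ} (hp : 1 ≤ p) {N X : ℝ≥0∞} (hN1 : 1 ≤ N)
    (hN : ∀ᵐ x ∂m, ((s.filter fun i => F i x ≠ 0).card : ℝ≥0∞) ≤ N)
    (hX : ∀ i ∈ s, eLpNorm (F i) (ENNReal.ofReal p) m ≤ X) :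
    eLpNorm (fun x => ∑ i ∈ s, c i * F i x) (ENNReal.ofReal p) m ≤
      N * X * (∑ i ∈ s, ‖c i‖ₑ ^ p) ^ (1 / p) := by
  have hp0 : 0 < p := by linarith
  have hpne : ENNReal.ofReal p ≠ 0 := by simpa using hp0
  have key : ∀ G : I → ℂ, eLpNorm G (ENNReal.ofReal p) m = (∫⁻ x, ‖G x‖ₑ ^ p ∂m) ^ (1 / p) := by
    intro G
    rw [eLpNorm_eq_lintegral_rpow_enorm_toReal hpne ENNReal.ofReal_ne_top,
      ENNReal.toReal_ofReal hp0.le]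
  have hX' : ∀ i ∈ s, ∫⁻ x, ‖F i x‖ₑ ^ p ∂m ≤ X ^ p := by
    intro i hi
    have := hX i hi
    rw [key] at this
    have := ENNReal.rpow_le_rpow this hp0.le
    rwa [← ENNReal.rpow_mul, one_div_mul_cancel hp0.ne', ENNReal.rpow_one] at this
  rw [key]
  have main : ∫⁻ x, ‖∑ i ∈ s, c i * F i x‖ₑ ^ p ∂m ≤
      N ^ p * ∑ i ∈ s, ‖c i‖ₑ ^ p * X ^ p := by
    calc _ ≤ ∫⁻ x, N ^ p * ∑ i ∈ s, ‖c i‖ₑ ^ p * ‖F i x‖ₑ ^ p ∂m := by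
          apply lintegral_mono_ae
          filter_upwards [hN] with x hx
          calc _ ≤ (∑ i ∈ s, ‖c i * F i x‖ₑ) ^ p := by
                gcongr
                exact enorm_sum_le _ _
            _ ≤ N ^ p * ∑ i ∈ s, ‖c i * F i x‖ₑ ^ p := by
                apply ENNReal.rpow_sum_le_of_card_support_le _ _ hp hN1
                refine le_trans ?_ hx
                gcongr with i hi
                exact fun h => by simp [h]
            _ = _ := by
                congr 1
                refine Finset.sum_congr rfl fun i _ => ?_
                rw [enorm_mul, ENNReal.mul_rpow_of_nonneg _ _ hp0.le]
      _ ≤ N ^ p * ∫⁻ x, ∑ i ∈ s, ‖c i‖ₑ ^ p * ‖F i x‖ₑ ^ p ∂m := by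
          rw [lintegral_const_mul'']
          refine Finset.aemeasurable_fun_sum _ fun i hi => ?_
          exact ((hF i hi).enorm.pow_const p).const_mul _
      _ = N ^ p * ∑ i ∈ s, ‖c i‖ₑ ^ p * ∫⁻ x, ‖F i x‖ₑ ^ p ∂m := by
          rw [lintegral_finsetSum' _ fun i hi => ((hF i hi).enorm.pow_const p).const_mul _]
          congr 1
          refine Finset.sum_congr rfl fun i hi => ?_
          rw [lintegral_const_mul'' _ ((hF i hi).enorm.pow_const p)]
      _ ≤ _ := by
          gcongr with i hi
          exact hX' i hi
  calc _ ≤ (N ^ p * ∑ i ∈ s, ‖c i‖ₑ ^ p * X ^ p) ^ (1 / p) := by gcongr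
    _ = _ := by
        rw [← Finset.sum_mul, mul_comm (∑ i ∈ s, _), ← mul_assoc, ← ENNReal.mul_rpow_of_nonneg _ _ hp0.le,
          ENNReal.mul_rpow_of_nonneg _ _ (by positivity), ← ENNReal.rpow_mul, mul_one_div_cancel hp0.ne',
          ENNReal.rpow_one]

theorem ENNReal.tsum_sum_range_mul_pow_sub (L : ℕ → ℝ≥0∞) (μ : ℝ≥0∞) :
    ∑' j, ∑ k ∈ Finset.range (j + 1), μ ^ (j - k) * L k = (1 - μ)⁻¹ * ∑' k, L k := by
  have h1 : ∀ j, ∑ k ∈ Finset.range (j + 1), μ ^ (j - k) * L k =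
      ∑' k, if k ≤ j then μ ^ (j - k) * L k else 0 := by
    intro j
    rw [tsum_eq_sum (s := Finset.range (j + 1))]
    · refine Finset.sum_congr rfl fun k hk => ?_
      rw [if_pos (by simpa [Nat.lt_succ_iff] using hk)]
    · intro k hk
      rw [if_neg (by simpa [Nat.lt_succ_iff] using hk)]
  simp_rw [h1]
  rw [ENNReal.tsum_comm, ← ENNReal.tsum_mul_left]
  congr 1
  ext k
  rw [← ENNReal.tsum_geometric, ← ENNReal.tsum_mul_right,
    ← Summable.sum_add_tsum_nat_add' (k := k) ENNReal.summable]
  · rw [Finset.sum_eq_zero, zero_add]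
    · congr 1
      ext i
      simp
    · intro j hj
      rw [if_neg (by simpa using hj)]

theorem ENNReal.sum_range_pow_sub_le (μ : ℝ≥0∞) (j : ℕ) :
    ∑ k ∈ Finset.range (j + 1), μ ^ (j - k) ≤ (1 - μ)⁻¹ := by
  rw [← ENNReal.tsum_geometric, ← Finset.sum_range_reflect]
  refine le_trans (le_of_eq ?_) (ENNReal.sum_le_tsum (Finset.range (j + 1)))
  refine Finset.sum_congr rfl fun k hk => ?_
  congr 1
  have := Finset.mem_range.1 hk
  omega

/-- The weights `μ ^ (j - k)` have total mass at most `(1 - μ)⁻¹`; Hölder's inequality for these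
weights, followed by an exchange of sums, gives this form of Young's inequality. -/
theorem ENNReal.Lp_convolution_pow_le (L E : ℕ → ℝ≥0∞) (K μ : ℝ≥0∞) {q : ℝ} (hq : 1 ≤ q)
    (hE : ∀ j, E j ≤ K * ∑ k ∈ Finset.range (j + 1), μ ^ (j - k) * L k) :
    (∑' j, E j ^ q) ^ (1 / q) ≤ K * (1 - μ)⁻¹ * (∑' k, L k ^ q) ^ (1 / q) := by
  have hq0 : 0 < q := by linarith
  set W := (1 - μ)⁻¹ with hW
  have h1 : ∀ j, E j ^ q ≤ K ^ q * (W ^ (q - 1) *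
      ∑ k ∈ Finset.range (j + 1), μ ^ (j - k) * L k ^ q) := by
    intro j
    calc _ ≤ (K * ∑ k ∈ Finset.range (j + 1), μ ^ (j - k) * L k) ^ q := by
          gcongr
          exact hE j
      _ = K ^ q * (∑ k ∈ Finset.range (j + 1), μ ^ (j - k) * L k) ^ q :=
          ENNReal.mul_rpow_of_nonneg _ _ hq0.le
      _ ≤ K ^ q * ((W ^ (1 - q⁻¹) *
          (∑ k ∈ Finset.range (j + 1), μ ^ (j - k) * L k ^ q) ^ q⁻¹)) ^ q := by
          gcongr
          refine (ENNReal.inner_le_weight_mul_Lp_of_nonneg _ hq _ _).trans ?_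
          gcongr
          · have := inv_le_one_of_one_le₀ hq
            linarith
          · exact ENNReal.sum_range_pow_sub_le μ j
      _ = _ := by
          rw [ENNReal.mul_rpow_of_nonneg _ _ hq0.le, ← ENNReal.rpow_mul, ← ENNReal.rpow_mul,
            inv_mul_cancel₀ hq0.ne', ENNReal.rpow_one, sub_mul, inv_mul_cancel₀ hq0.ne', one_mul]
  calc _ ≤ (K ^ q * (W ^ (q - 1) * (W * ∑' k, L k ^ q))) ^ (1 / q) := by
        gcongr
        rw [hW, ← ENNReal.tsum_sum_range_mul_pow_sub, ← hW, ← ENNReal.tsum_mul_left,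
          ← ENNReal.tsum_mul_left]
        exact ENNReal.tsum_le_tsum h1
    _ = ((K * W) ^ q * ∑' k, L k ^ q) ^ (1 / q) := by
        congr 1
        rw [ENNReal.mul_rpow_of_nonneg _ _ hq0.le, ← mul_assoc (W ^ (q - 1)), ← mul_assoc]
        congr 2
        nth_rw 2 [← ENNReal.rpow_one W]
        rw [← ENNReal.rpow_add_of_nonneg _ _ (by linarith) (by norm_num)]
        congr 1
        ring
    _ = _ := by
        rw [ENNReal.mul_rpow_of_nonneg _ _ (by positivity), ← ENNReal.rpow_mul,
          mul_one_div_cancel hq0.ne', ENNReal.rpow_one]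

theorem ENNReal.iSup_convolution_pow_le (L E : ℕ → ℝ≥0∞) (K μ : ℝ≥0∞)
    (hE : ∀ j, E j ≤ K * ∑ k ∈ Finset.range (j + 1), μ ^ (j - k) * L k) :
    ⨆ j, E j ≤ K * (1 - μ)⁻¹ * ⨆ k, L k := by
  refine iSup_le fun j => (hE j).trans ?_
  rw [mul_assoc]
  gcongr
  calc _ ≤ ∑ k ∈ Finset.range (j + 1), μ ^ (j - k) * ⨆ k, L k := by
        gcongr with k
        exact le_iSup L k
    _ ≤ _ := by
        rw [← Finset.sum_mul]
        gcongr
        exact ENNReal.sum_range_pow_sub_le μ j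

theorem ENNReal.Lp_sum_le {ι κ : Type*} (s : Finset ι) (T : Finset κ) (y : κ → ι → ℝ≥0∞) {p : ℝ}
    (hp : 1 ≤ p) :
    (∑ i ∈ s, (∑ k ∈ T, y k i) ^ p) ^ (1 / p) ≤ ∑ k ∈ T, (∑ i ∈ s, y k i ^ p) ^ (1 / p) := by
  classical
  induction T using Finset.induction_on with
  | empty => simp [show 0 < p by linarith]
  | insert k T hk ih =>
    simp_rw [Finset.sum_insert hk]
    refine (ENNReal.Lp_add_le s _ _ hp).trans ?_
    gcongr

theorem coeffNorm_mono {I : Type*} (P : ℕ → Finset (Set I)) {p : ℝ} (hp : 1 ≤ p) (q : ℝ≥0∞)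
    {c c' : ℕ → Set I → ℂ} (h : ∀ k, ∀ Q ∈ P k, ‖c k Q‖ ≤ ‖c' k Q‖) :
    coeffNorm P p q c ≤ coeffNorm P p q c' := by
  have hp0 : 0 < p := by linarith
  have h1 : ∀ k, ∑ Q ∈ P k, ‖c k Q‖ₑ ^ p ≤ ∑ Q ∈ P k, ‖c' k Q‖ₑ ^ p := by
    intro k
    gcongr with Q hQ
    exact enorm_le_iff_norm_le.2 (h k Q hQ)
  unfold coeffNorm
  split_ifs
  · exact iSup_mono fun k => ENNReal.rpow_le_rpow (h1 k) (by positivity)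
  · exact ENNReal.rpow_le_rpow (ENNReal.tsum_le_tsum fun k =>
      ENNReal.rpow_le_rpow (h1 k) (by positivity)) (by positivity)

theorem level_le_coeffNorm {I : Type*} (P : ℕ → Finset (Set I)) {p : ℝ} {q : ℝ≥0∞}
    (hq : 1 ≤ q) (c : ℕ → Set I → ℂ) (k : ℕ) :
    (∑ Q ∈ P k, ‖c k Q‖ₑ ^ p) ^ (1 / p) ≤ coeffNorm P p q c := by
  unfold coeffNorm
  split_ifs with h
  · exact le_iSup (fun k => (∑ Q ∈ P k, ‖c k Q‖ₑ ^ p) ^ (1 / p)) k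
  · have hq0 : 0 < q.toReal := ENNReal.toReal_pos (by positivity) h
    calc _ = ((∑ Q ∈ P k, ‖c k Q‖ₑ ^ p) ^ (q.toReal / p)) ^ (1 / q.toReal) := by
          rw [← ENNReal.rpow_mul]
          congr 1
          field_simp
      _ ≤ _ := by
          gcongr
          exact ENNReal.le_tsum (f := fun k => (∑ Q ∈ P k, ‖c k Q‖ₑ ^ p) ^ (q.toReal / p)) k

theorem coeffNorm_le_of_convolution {I : Type*} (P : ℕ → Finset (Set I)) {p : ℝ}
    {q : ℝ≥0∞} (hq : 1 ≤ q) (c e : ℕ → Set I → ℂ) (K μ : ℝ≥0∞)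
    (h : ∀ j, (∑ R ∈ P j, ‖e j R‖ₑ ^ p) ^ (1 / p) ≤
      K * ∑ k ∈ Finset.range (j + 1), μ ^ (j - k) * (∑ Q ∈ P k, ‖c k Q‖ₑ ^ p) ^ (1 / p)) :
    coeffNorm P p q e ≤ K * (1 - μ)⁻¹ * coeffNorm P p q c := by
  unfold coeffNorm
  split_ifs with hq'
  · exact ENNReal.iSup_convolution_pow_le _ _ K μ h
  · have hq1 : 1 ≤ q.toReal := by
      rw [← ENNReal.toReal_one]
      exact ENNReal.toReal_mono hq' hq
    have := ENNReal.Lp_convolution_pow_le _ _ K μ hq1 h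
    simpa only [← ENNReal.rpow_mul, one_div_mul_eq_div] using this

/-- The sums telescope: as `r k k = F k`, the sum of the `G j` over `j < n` is that of the `F k`
over `k < n` minus the `n` remainders `r k n`, each `O(θ ^ n)`. The factor `n` is harmless since `n
θ ^ n` is summable and tends to `0`. -/
theorem tendsto_eLpNorm_sub_sum_of_remainders {I : Type*} [MeasurableSpace I] {m : Measure I}
    {p : ℝ≥0∞} (hp : 1 ≤ p) (f : I → ℂ) (F : ℕ → I → ℂ) (r : ℕ → ℕ → I → ℂ) (G : ℕ → I → ℂ)
    (hf : AEStronglyMeasurable f m) (hF : ∀ k, AEStronglyMeasurable (F k) m)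
    (hr : ∀ k N, AEStronglyMeasurable (r k N) m)
    (hrF : ∀ k, r k k =ᵐ[m] F k)
    (hG : ∀ j, ∀ᵐ x ∂m, G j x = ∑ k ∈ Finset.range (j + 1), (r k j x - r k (j + 1) x))
    {B : ℝ≥0∞} (hB : B ≠ ∞) {θ : ℝ≥0} (hθ : θ < 1)
    (hrB : ∀ k N, k ≤ N → eLpNorm (r k N) p m ≤ B * (θ : ℝ≥0∞) ^ N)
    (hlim : Tendsto (fun n => eLpNorm (fun x => f x - ∑ k ∈ Finset.range n, F k x) p m)
      atTop (𝓝 0)) :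
    ∑' j, eLpNorm (G j) p m < ∞ ∧
      Tendsto (fun n => eLpNorm (fun x => f x - ∑ j ∈ Finset.range n, G j x) p m)
        atTop (𝓝 0) := by
  constructor
  · have h1 : ∀ j, eLpNorm (G j) p m ≤ 2 * B * (((j + 1 : ℕ) * θ ^ j : ℝ≥0) : ℝ≥0∞) := by
      intro j
      rw [eLpNorm_congr_ae (hG j)]
      have h2 : (fun x => ∑ k ∈ Finset.range (j + 1), (r k j x - r k (j + 1) x)) =
          ∑ k ∈ Finset.range (j + 1), (r k j - r k (j + 1)) := by
        ext x
        simp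
      rw [h2]
      refine (eLpNorm_sum_le (fun k _ => (hr k j).sub (hr k (j + 1))) hp).trans ?_
      calc _ ≤ ∑ k ∈ Finset.range (j + 1), 2 * B * (θ : ℝ≥0∞) ^ j := by
            gcongr with k hk
            have hk' : k ≤ j := Nat.lt_succ_iff.1 (Finset.mem_range.1 hk)
            refine (eLpNorm_sub_le (hr k j) (hr k (j + 1)) hp).trans ?_
            rw [mul_assoc, two_mul]
            gcongr
            · exact hrB k j hk'
            · refine (hrB k (j + 1) (by omega)).trans ?_
              exact mul_le_mul_right (pow_le_pow_of_le_one zero_le (by exact_mod_cast hθ.le)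
                (by omega)) _
        _ = _ := by
            rw [Finset.sum_const, Finset.card_range, nsmul_eq_mul]
            push_cast
            ring
    refine (ENNReal.tsum_le_tsum h1).trans_lt ?_
    rw [ENNReal.tsum_mul_left]
    refine ENNReal.mul_lt_top (ENNReal.mul_lt_top (by simp) hB.lt_top) ?_
    rw [lt_top_iff_ne_top, ENNReal.tsum_coe_ne_top_iff_summable, ← NNReal.summable_coe]
    have h3 : ‖(θ : ℝ)‖ < 1 := by simpa using hθ
    have := (summable_pow_mul_geometric_of_norm_lt_one 1 h3).add
      (summable_geometric_of_norm_lt_one h3)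
    refine this.congr fun j => ?_
    push_cast
    ring
  · have h1 : ∀ᵐ x ∂m, ∀ n, ∑ j ∈ Finset.range n, G j x =
        ∑ k ∈ Finset.range n, F k x - ∑ k ∈ Finset.range n, r k n x := by
      filter_upwards [ae_all_iff.2 hG, ae_all_iff.2 hrF] with x hx hx' n
      induction n with
      | zero => simp
      | succ n ih =>
        rw [Finset.sum_range_succ, ih, hx n, Finset.sum_sub_distrib,
          Finset.sum_range_succ (fun k => F k x), Finset.sum_range_succ (fun k => r k n x), hx' n]
        ring
    have h2 : ∀ n, eLpNorm (fun x => f x - ∑ j ∈ Finset.range n, G j x) p m ≤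
        eLpNorm (fun x => f x - ∑ k ∈ Finset.range n, F k x) p m +
          B * ((n * θ ^ n : ℝ≥0) : ℝ≥0∞) := by
      intro n
      have h3 : (fun x => f x - ∑ j ∈ Finset.range n, G j x) =ᵐ[m]
          (fun x => f x - ∑ k ∈ Finset.range n, F k x) + ∑ k ∈ Finset.range n, r k n := by
        filter_upwards [h1] with x hx
        simp only [hx n, Pi.add_apply, Finset.sum_apply]
        ring
      rw [eLpNorm_congr_ae h3]
      have h6 : AEStronglyMeasurable (fun x => f x - ∑ k ∈ Finset.range n, F k x) m :=
        hf.sub (Finset.aestronglyMeasurable_fun_sum _ fun k _ => hF k)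
      refine (eLpNorm_add_le h6
        (Finset.aestronglyMeasurable_sum _ fun k _ => hr k n) hp).trans (add_le_add le_rfl ?_)
      refine (eLpNorm_sum_le (fun k _ => hr k n) hp).trans ?_
      calc _ ≤ ∑ k ∈ Finset.range n, B * (θ : ℝ≥0∞) ^ n := by
            gcongr with k hk
            exact hrB k n (Finset.mem_range.1 hk).le
        _ = _ := by
            rw [Finset.sum_const, Finset.card_range, nsmul_eq_mul]
            push_cast
            ring
    have h4 : Tendsto (fun n : ℕ => B * ((n * θ ^ n : ℝ≥0) : ℝ≥0∞)) atTop (𝓝 0) := by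
      have : Tendsto (fun n : ℕ => (n * θ ^ n : ℝ≥0)) atTop (𝓝 0) := by
        rw [← NNReal.tendsto_coe]
        push_cast
        exact tendsto_self_mul_const_pow_of_lt_one θ.2 (by exact_mod_cast hθ)
      have := ENNReal.Tendsto.const_mul (ENNReal.tendsto_coe.2 this) (Or.inr hB)
      simpa using this
    have h5 := hlim.add h4
    rw [add_zero] at h5
    exact tendsto_of_tendsto_of_tendsto_of_le_of_le tendsto_const_nhds h5 (fun _ => zero_le) h2

/-! ### Transfer from one kind of atoms to another -/

/-- A gauge on the functions attached to each cell: `G k Q t u` reads "`u` is `t` times an atom". -/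
structure IsAtomGauge {I : Type*} (G : ℕ → Set I → ℝ≥0 → (I → ℂ) → Prop) : Prop where
  zero : ∀ k Q, G k Q 0 0
  add : ∀ k Q t t' u u', G k Q t u → G k Q t' u' → G k Q (t + t') (u + u')
  smul : ∀ k Q t u (b : ℂ), G k Q t u → G k Q (‖b‖₊ * t) (b • u)

theorem IsAtomGauge.sum {I ι : Type*} {G : ℕ → Set I → ℝ≥0 → (I → ℂ) → Prop} (hG : IsAtomGauge G)
    (k : ℕ) (Q : Set I) (T : Finset ι) (t : ι → ℝ≥0) (u : ι → I → ℂ)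
    (h : ∀ i ∈ T, G k Q (t i) (u i)) : G k Q (∑ i ∈ T, t i) (∑ i ∈ T, u i) := by
  classical
  induction T using Finset.induction_on with
  | empty => simpa using hG.zero k Q
  | insert i T hi ih =>
    rw [Finset.sum_insert hi, Finset.sum_insert hi]
    exact hG.add _ _ _ _ _ _ (h i (by simp)) (ih fun i' hi' => h i' (by simp [hi']))

/-- Approximants `S k Q N` of the atoms `a k Q`, whose increments are sums of multiples
`u k Q j R` of atoms of another kind, with geometrically decaying sizes. -/
structure IsAtomicTransfer {I : Type*} [MeasurableSpace I] (m : Measure I) (P : ℕ → Finset (Set I))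
    (p : ℝ) (a : ℕ → Set I → I → ℂ) (S : ℕ → Set I → ℕ → I → ℂ)
    (u : ℕ → Set I → ℕ → Set I → I → ℂ) (G : ℕ → Set I → ℝ≥0 → (I → ℂ) → Prop)
    (Γ μ ν θ : ℝ≥0) : Prop where
  aestronglyMeasurable : ∀ k, ∀ Q ∈ P k, AEStronglyMeasurable (a k Q) m
  aestronglyMeasurable_approx : ∀ k, ∀ Q ∈ P k, ∀ N, AEStronglyMeasurable (S k Q N) m
  eq_zero : ∀ k, ∀ Q ∈ P k, ∀ N ≤ k, S k Q N = 0
  sub_eq : ∀ k, ∀ Q ∈ P k, ∀ j, k ≤ j →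
    ∀ᵐ x ∂m, S k Q (j + 1) x - S k Q j x = ∑ R ∈ P j, u k Q j R x
  gauge : ∀ k, ∀ Q ∈ P k, ∀ j, k ≤ j → ∀ R ∈ P j, G j R (Γ * μ ^ (j - k)) (u k Q j R)
  card_target : ∀ k, ∀ Q ∈ P k, ∀ j, k ≤ j →
    ({R ∈ (P j : Set (Set I)) | u k Q j R ≠ 0}.ncard : ℝ≥0) ≤ Γ * ν ^ (j - k)
  card_source : ∀ j, ∀ R ∈ P j, ∀ k ≤ j,
    ({Q ∈ (P k : Set (Set I)) | u k Q j R ≠ 0}.ncard : ℝ≥0) ≤ Γ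
  approx : ∀ k, ∀ Q ∈ P k, ∀ N, k ≤ N →
    eLpNorm (fun x => a k Q x - S k Q N x) (ENNReal.ofReal p) m ≤ Γ * (θ : ℝ≥0∞) ^ N
  overlap : ∀ k N, k ≤ N →
    ∀ᵐ x ∂m, ({Q ∈ (P k : Set (Set I)) | a k Q x - S k Q N x ≠ 0}.ncard : ℝ≥0) ≤ Γ

/-- For fixed `R` at most `Γ` of the `Q` contribute, so the power passes inside the sum; after the
exchange of sums each `Q` is counted for at most `M` of the `R`. The count `M` thus enters outside
the power `p`, and only as `M ^ (1 / p)` in the end. -/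
theorem schur_level_le {α β : Type*} (T : Finset α) (U : Finset β) (c : α → ℝ≥0∞)
    (Z : α → β → Prop) [∀ Q R, Decidable (Z Q R)] {p : ℝ} (hp : 1 ≤ p) {Γ M d : ℝ≥0∞} (hΓ : 1 ≤ Γ)
    (h1 : ∀ R ∈ U, ((T.filter fun Q => Z Q R).card : ℝ≥0∞) ≤ Γ)
    (h2 : ∀ Q ∈ T, ((U.filter fun R => Z Q R).card : ℝ≥0∞) ≤ M) :
    (∑ R ∈ U, (∑ Q ∈ T, c Q * if Z Q R then d else 0) ^ p) ^ (1 / p) ≤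
      Γ * d * M ^ (1 / p) * (∑ Q ∈ T, c Q ^ p) ^ (1 / p) := by
  have hp0 : 0 < p := by linarith
  have key : ∑ R ∈ U, (∑ Q ∈ T, c Q * if Z Q R then d else 0) ^ p ≤
      (Γ * d) ^ p * M * ∑ Q ∈ T, c Q ^ p := by
    calc _ ≤ ∑ R ∈ U, Γ ^ p * ∑ Q ∈ T, (c Q * if Z Q R then d else 0) ^ p := by
          gcongr with R hR
          refine ENNReal.rpow_sum_le_of_card_support_le _ _ hp hΓ (le_trans ?_ (h1 R hR))
          gcongr with Q hQ
          intro h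
          by_contra h'
          simp [h'] at h
      _ = Γ ^ p * ∑ Q ∈ T, c Q ^ p * ∑ R ∈ U, if Z Q R then d ^ p else 0 := by
          rw [← Finset.mul_sum, Finset.sum_comm]
          congr 1
          refine Finset.sum_congr rfl fun Q _ => ?_
          rw [Finset.mul_sum]
          refine Finset.sum_congr rfl fun R _ => ?_
          rw [ENNReal.mul_rpow_of_nonneg _ _ hp0.le]
          split_ifs
          · rfl
          · rw [ENNReal.zero_rpow_of_pos hp0]
      _ ≤ Γ ^ p * ∑ Q ∈ T, c Q ^ p * (M * d ^ p) := by
          gcongr with Q hQ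
          rw [← Finset.sum_filter, Finset.sum_const, nsmul_eq_mul]
          gcongr
          exact h2 Q hQ
      _ = _ := by
          rw [← Finset.sum_mul, ENNReal.mul_rpow_of_nonneg _ _ hp0.le]
          ring
  calc _ ≤ ((Γ * d) ^ p * M * ∑ Q ∈ T, c Q ^ p) ^ (1 / p) := by gcongr
    _ = _ := by
        rw [ENNReal.mul_rpow_of_nonneg _ _ (by positivity),
          ENNReal.mul_rpow_of_nonneg _ _ (by positivity), ← ENNReal.rpow_mul,
          mul_one_div_cancel hp0.ne', ENNReal.rpow_one]

/-- All contributions to a cell `R` of level `j` are added into one function `U j R`, and their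
gauges into one coefficient `e j R`. The constant depends only on `Γ`, `μ`, `ν`, `p`, which makes it
uniform over the families of atoms. -/
theorem IsAtomicTransfer.exists_rep {I : Type*} [MeasurableSpace I] {m : Measure I}
    {P : ℕ → Finset (Set I)} {p : ℝ} {G : ℕ → Set I → ℝ≥0 → (I → ℂ) → Prop} (hG : IsAtomGauge G)
    (hp : 1 ≤ p) {q : ℝ≥0∞} (hq : 1 ≤ q) {Γ μ ν θ : ℝ≥0} (hΓ : 1 ≤ Γ) (hθ : θ < 1)
    (hμν : (μ : ℝ) ^ p * ν < 1) :
    ∃ K : ℝ≥0, 0 < K ∧ ∀ a S u c f, IsAtomicTransfer m P p a S u G Γ μ ν θ →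
      AEStronglyMeasurable f m → IsAtomicSum m P p a c f → coeffNorm P p q c < ∞ →
      ∃ (e : ℕ → Set I → ℝ≥0) (U : ℕ → Set I → I → ℂ),
        (∀ j, ∀ R ∈ P j, G j R (e j R) (U j R)) ∧ IsAtomicSum m P p U 1 f ∧
        coeffNorm P p q (fun j R => ((e j R : ℝ) : ℂ)) ≤ K * coeffNorm P p q c := by
  classical
  have hp0 : 0 < p := by linarith
  have hp1 : 1 ≤ ENNReal.ofReal p := by simpa using hp
  set τ : ℝ≥0 := μ * ν ^ (1 / p) with hτ
  have hτ1 : τ < 1 := by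
    have h1 : (τ : ℝ) ^ p < 1 := by
      rw [hτ]
      push_cast
      rw [Real.mul_rpow (by positivity) (by positivity), ← Real.rpow_mul (by positivity),
        one_div_mul_cancel hp0.ne', Real.rpow_one]
      exact hμν
    by_contra h
    have h2 : (1 : ℝ) ≤ τ := by exact_mod_cast not_lt.1 h
    exact absurd (Real.one_le_rpow h2 hp0.le) (not_le.2 h1)
  have hK : (Γ : ℝ≥0∞) * Γ * (Γ : ℝ≥0∞) ^ (1 / p) * (1 - (τ : ℝ≥0∞))⁻¹ ≠ ∞ := by
    refine ENNReal.mul_ne_top (ENNReal.mul_ne_top (by finiteness)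
      (ENNReal.rpow_ne_top_of_nonneg (by positivity) ENNReal.coe_ne_top)) ?_
    rw [ENNReal.inv_ne_top]
    exact (tsub_pos_of_lt (by exact_mod_cast hτ1)).ne'
  refine ⟨((Γ : ℝ≥0∞) * Γ * (Γ : ℝ≥0∞) ^ (1 / p) * (1 - (τ : ℝ≥0∞))⁻¹).toNNReal + 1,
    by positivity, ?_⟩
  intro a S u c f h hf hsum hc
  -- `D` is zero where the piece vanishes, so that only the pairs counted by `card_source` and
  -- `card_target` enter the Schur estimate.
  set D : ℕ → Set I → ℕ → Set I → ℝ≥0 := fun k Q j R =>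
    if u k Q j R ≠ 0 then Γ * μ ^ (j - k) else 0 with hD
  set e : ℕ → Set I → ℝ≥0 := fun j R =>
    ∑ k ∈ Finset.range (j + 1), ∑ Q ∈ P k, ‖c k Q‖₊ * D k Q j R with he
  set U : ℕ → Set I → I → ℂ := fun j R =>
    ∑ k ∈ Finset.range (j + 1), ∑ Q ∈ P k, c k Q • u k Q j R with hU
  refine ⟨e, U, ?_, ?_, ?_⟩
  · intro j R hR
    refine hG.sum _ _ _ _ _ fun k hk => hG.sum _ _ _ _ _ fun Q hQ => hG.smul _ _ _ _ _ ?_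
    have hk' : k ≤ j := Nat.lt_succ_iff.1 (Finset.mem_range.1 hk)
    by_cases hu : u k Q j R = 0
    · simp only [hD, hu, ne_eq, not_true_eq_false, if_false]
      exact hG.zero j R
    · simp only [hD, ne_eq, hu, not_false_eq_true, if_true]
      exact h.gauge k Q hQ j hk' R hR
  · have hmeas : ∀ k N, ∀ Q ∈ P k, AEStronglyMeasurable (fun x => a k Q x - S k Q N x) m :=
      fun k N Q hQ => (h.aestronglyMeasurable k Q hQ).sub (h.aestronglyMeasurable_approx k Q hQ N)
    refine tendsto_eLpNorm_sub_sum_of_remainders hp1 f (fun k x => ∑ Q ∈ P k, c k Q * a k Q x)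
      (fun k N x => ∑ Q ∈ P k, c k Q * (a k Q x - S k Q N x)) _ hf ?_ ?_ ?_ ?_
      (B := Γ * Γ * coeffNorm P p q c) (by finiteness) hθ ?_ hsum.2
    · exact fun k => Finset.aestronglyMeasurable_fun_sum _ fun Q hQ =>
        (h.aestronglyMeasurable k Q hQ).const_mul _
    · exact fun k N => Finset.aestronglyMeasurable_fun_sum _ fun Q hQ =>
        (hmeas k N Q hQ).const_mul _
    · intro k
      refine Filter.Eventually.of_forall fun x => Finset.sum_congr rfl fun Q hQ => ?_
      rw [h.eq_zero k Q hQ k le_rfl]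
      simp
    · intro j
      have h1 : ∀ᵐ x ∂m, ∀ k ∈ Finset.range (j + 1), ∀ Q ∈ P k,
          S k Q (j + 1) x - S k Q j x = ∑ R ∈ P j, u k Q j R x := by
        rw [Filter.eventually_all_finset]
        intro k hk
        rw [Filter.eventually_all_finset]
        exact fun Q hQ => h.sub_eq k Q hQ j (Nat.lt_succ_iff.1 (Finset.mem_range.1 hk))
      filter_upwards [h1] with x hx
      simp only [hU, Pi.one_apply, one_mul, Finset.sum_apply, Pi.smul_apply, smul_eq_mul]
      rw [Finset.sum_comm]
      refine Finset.sum_congr rfl fun k hk => ?_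
      rw [Finset.sum_comm, ← Finset.sum_sub_distrib]
      refine Finset.sum_congr rfl fun Q hQ => ?_
      rw [← Finset.mul_sum, ← hx k hk Q hQ]
      ring
    · intro k N hkN
      refine (eLpNorm_sum_mul_le_of_overlap (P k) (c k) _ (fun Q hQ => hmeas k N Q hQ) hp
        (N := Γ) (X := Γ * (θ : ℝ≥0∞) ^ N) (by exact_mod_cast hΓ) ?_
        (fun Q hQ => h.approx k Q hQ N hkN)).trans ?_
      · filter_upwards [h.overlap k N hkN] with x hx
        rw [← Set.ncard_coe_finset, Finset.coe_filter]
        exact_mod_cast hx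
      · calc _ ≤ Γ * (Γ * (θ : ℝ≥0∞) ^ N) * coeffNorm P p q c := by
              gcongr
              exact level_le_coeffNorm P hq c k
          _ = _ := by ring
  · have hle : (Γ : ℝ≥0∞) * Γ * (Γ : ℝ≥0∞) ^ (1 / p) * (1 - (τ : ℝ≥0∞))⁻¹ ≤
        ((((Γ : ℝ≥0∞) * Γ * (Γ : ℝ≥0∞) ^ (1 / p) * (1 - (τ : ℝ≥0∞))⁻¹).toNNReal + 1 : ℝ≥0) :
          ℝ≥0∞) := by
      rw [ENNReal.coe_add, ENNReal.coe_toNNReal hK]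
      exact le_self_add
    refine le_trans ?_ (mul_le_mul' hle le_rfl)
    refine coeffNorm_le_of_convolution P hq c _ _ τ fun j => ?_
    have h1 : ∀ R, ‖((e j R : ℝ) : ℂ)‖ₑ =
        ∑ k ∈ Finset.range (j + 1), ∑ Q ∈ P k, ‖c k Q‖ₑ * (D k Q j R : ℝ≥0∞) := by
      intro R
      have : ‖((e j R : ℝ) : ℂ)‖₊ = e j R := by
        ext
        simp
      rw [enorm_eq_nnnorm, this, he]
      push_cast
      rfl
    simp_rw [h1]
    refine (ENNReal.Lp_sum_le _ _ _ hp).trans ?_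
    rw [Finset.mul_sum]
    refine Finset.sum_le_sum fun k hk => ?_
    have hk' : k ≤ j := Nat.lt_succ_iff.1 (Finset.mem_range.1 hk)
    have h2 : ∀ Q R, (D k Q j R : ℝ≥0∞) =
        if u k Q j R ≠ 0 then (Γ : ℝ≥0∞) * (μ : ℝ≥0∞) ^ (j - k) else 0 := by
      intro Q R
      simp only [hD]
      split_ifs <;> simp
    simp_rw [h2]
    refine (schur_level_le (P k) (P j) (fun Q => ‖c k Q‖ₑ) (fun Q R => u k Q j R ≠ 0) hp
      (Γ := Γ) (M := Γ * (ν : ℝ≥0∞) ^ (j - k)) (by exact_mod_cast hΓ) ?_ ?_).trans (le_of_eq ?_)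
    · intro R hR
      rw [← Set.ncard_coe_finset, Finset.coe_filter]
      exact_mod_cast h.card_source j R hR k hk'
    · intro Q hQ
      rw [← Set.ncard_coe_finset, Finset.coe_filter]
      exact_mod_cast h.card_target k Q hQ j hk'
    · have h3 : (τ : ℝ≥0∞) = μ * (ν : ℝ≥0∞) ^ (1 / p) := by
        rw [hτ, ENNReal.coe_mul, ENNReal.coe_rpow_of_nonneg _ (by positivity)]
      rw [h3, mul_pow, ENNReal.mul_rpow_of_nonneg _ _ (by positivity), ← ENNReal.rpow_natCast_mul,
        ← ENNReal.rpow_mul_natCast, mul_comm ((j - k : ℕ) : ℝ)]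
      ring

/-! ### Measures of balls for the Macías–Segovia quasi-metric -/

section MaciasSegovia

variable {I : Type*} {ρ : I → I → ℝ}

theorem IsQuasiMetric.nonneg (h : IsQuasiMetric ρ) (x y : I) : 0 ≤ ρ x y := by
  by_cases hxy : x = y
  · rw [hxy, h.self_eq_zero]
  · exact (h.pos_of_ne x y hxy).le

theorem IsQuasiMetric.mem_qBall_self (h : IsQuasiMetric ρ) (x : I) {r : ℝ}
    (hr : 0 < r) : x ∈ qBall ρ x r := by
  simpa [qBall, h.self_eq_zero] using hr

theorem qBall_mono (x : I) {r t : ℝ} (h : r ≤ t) : qBall ρ x r ⊆ qBall ρ x t :=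
  fun _ hy => lt_of_lt_of_le hy h

variable [MeasurableSpace I] {m : Measure I}

theorem msDist_nonneg (x y : I) : 0 ≤ msDist ρ m x y := by
  refine Real.sInf_nonneg ?_
  rintro v ⟨w, r, -, -, -, rfl⟩
  exact measureReal_nonneg

theorem msDist_symm (x y : I) : msDist ρ m x y = msDist ρ m y x := by
  unfold msDist
  congr 1
  ext v
  constructor <;>
  · rintro ⟨w, r, h0, h1, h2, h3⟩
    exact ⟨w, r, h0, h2, h1, h3⟩

theorem msDist_le_measureReal_qBall {x y w : I} {r : ℝ} (hr : 0 < r) (hx : x ∈ qBall ρ w r)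
    (hy : y ∈ qBall ρ w r) : msDist ρ m x y ≤ m.real (qBall ρ w r) := by
  refine csInf_le ⟨0, ?_⟩ ⟨w, r, hr, hx, hy, rfl⟩
  rintro v ⟨w, r, -, -, -, rfl⟩
  exact measureReal_nonneg

theorem IsQuasiMetric.exists_qBall_of_msDist_lt (h : IsQuasiMetric ρ) {x y : I} {r : ℝ}
    (hxy : msDist ρ m x y < r) :
    ∃ w t, 0 < t ∧ x ∈ qBall ρ w t ∧ y ∈ qBall ρ w t ∧ m.real (qBall ρ w t) < r := by
  have hne : {v : ℝ | ∃ w r, 0 < r ∧ x ∈ qBall ρ w r ∧ y ∈ qBall ρ w r ∧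
      v = m.real (qBall ρ w r)}.Nonempty :=
    ⟨_, x, ρ x y + 1, by linarith [h.nonneg x y],
      h.mem_qBall_self x (by linarith [h.nonneg x y]), by simp [qBall], rfl⟩
  obtain ⟨v, ⟨w, t, ht, hx, hy, rfl⟩, hv⟩ := exists_lt_of_csInf_lt hne hxy
  exact ⟨w, t, ht, hx, hy, hv⟩

variable [IsProbabilityMeasure m]

theorem IsQuasiMetric.msDist_le_one (h : IsQuasiMetric ρ) (x y : I) : msDist ρ m x y ≤ 1 := by
  have h0 := h.nonneg x y
  refine (msDist_le_measureReal_qBall (w := x) (r := ρ x y + 1) (by linarith)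
    (h.mem_qBall_self x (by linarith)) (by simp [qBall])).trans measureReal_le_one

variable [TopologicalSpace I]

theorem IsHomogeneousSpace.exists_doubling (hρ : IsHomogeneousSpace ρ m) :
    ∃ C : ℝ, 1 ≤ C ∧ ∀ x r, 0 < r → m.real (qBall ρ x (2 * r)) ≤ C * m.real (qBall ρ x r) := by
  obtain ⟨C, hC⟩ := hρ.doubling
  refine ⟨C + 1, by simp, fun x r hr => ?_⟩
  have h := (hC x (2 * r) (by positivity)).2.1.le
  rw [mul_div_cancel_left₀ r (two_ne_zero)] at h
  have h2 := ENNReal.toReal_mono (ENNReal.mul_ne_top ENNReal.coe_ne_top (measure_ne_top _ _)) h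
  rw [ENNReal.toReal_mul, ENNReal.coe_toReal] at h2
  calc _ ≤ C * m.real (qBall ρ x r) := h2
    _ ≤ _ := by
      have : 0 ≤ m.real (qBall ρ x r) := measureReal_nonneg
      linarith

/-- If `β(x, y) < r`, a `ρ`-ball of radius `t` and measure less than `r` contains both points. The
`ρ`-ball of centre `x` and radius `2 K t` contains `y` and lies in a fixed dilate of that ball. So
the `β`-ball is covered by `ρ`-balls about `x` of measure at most `C ^ n * r`, and one more doubling
reaches the supremum of their radii. -/
theorem IsHomogeneousSpace.exists_measureReal_msDist_lt_le (hρ : IsHomogeneousSpace ρ m) :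
    ∃ Λ : ℝ, 0 < Λ ∧ ∀ x r, 0 < r → m.real {y | msDist ρ m x y < r} ≤ Λ * r := by
  obtain ⟨C, hC1, hC⟩ := hρ.exists_doubling
  obtain ⟨K, hK1, hK⟩ := hρ.quasiMetric.exists_const
  obtain ⟨n, hn⟩ := pow_unbounded_of_one_lt (K * (1 + 2 * K)) (one_lt_two (α := ℝ))
  have hCn : ∀ (k : ℕ) w t, 0 < t → m.real (qBall ρ w (2 ^ k * t)) ≤ C ^ k * m.real (qBall ρ w t) := by
    intro k w t ht
    induction k with
    | zero => simp
    | succ k ih =>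
      rw [pow_succ', mul_assoc, pow_succ', mul_assoc]
      refine (hC w _ (by positivity)).trans ?_
      gcongr
  refine ⟨C * C ^ n, by positivity, fun x r hr => ?_⟩
  set T : Set ℝ := {t | 0 < t ∧ m.real (qBall ρ x t) ≤ C ^ n * r} with hT
  have hcov : ∀ y, msDist ρ m x y < r → ∃ t ∈ T, ρ x y < t := by
    intro y hy
    obtain ⟨w, t, ht, hx, hy, hlt⟩ := hρ.quasiMetric.exists_qBall_of_msDist_lt hy
    have hx' : ρ w x < t := hx
    have hy' : ρ w y < t := hy
    refine ⟨2 * K * t, ⟨by positivity, ?_⟩, ?_⟩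
    · calc _ ≤ m.real (qBall ρ w (2 ^ n * t)) := by
            refine measureReal_mono fun v hv => ?_
            have hv' : ρ x v < 2 * K * t := hv
            calc ρ w v ≤ K * (ρ w x + ρ x v) := hK w x v
              _ ≤ K * (t + 2 * K * t) := by gcongr
              _ = K * (1 + 2 * K) * t := by ring
              _ < 2 ^ n * t := by gcongr
        _ ≤ C ^ n * m.real (qBall ρ w t) := hCn n w t ht
        _ ≤ _ := by gcongr
    · calc ρ x y ≤ K * (ρ x w + ρ w y) := hK x w y
        _ < K * (t + t) := by
            rw [hρ.quasiMetric.symm x w]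
            gcongr
        _ = _ := by ring
  by_cases hbdd : BddAbove T
  · rcases T.eq_empty_or_nonempty with hTe | hTne
    · have : {y | msDist ρ m x y < r} = ∅ := by
        refine Set.eq_empty_of_forall_notMem fun y hy => ?_
        obtain ⟨t, ht, -⟩ := hcov y hy
        rw [hTe] at ht
        exact ht
      rw [this, measureReal_empty]
      positivity
    · have hpos : 0 < sSup T := by
        obtain ⟨t, ht⟩ := hTne
        exact ht.1.trans_le (le_csSup hbdd ht)
      obtain ⟨t, ht, hlt⟩ := exists_lt_of_lt_csSup hTne (half_lt_self hpos)
      calc _ ≤ m.real (qBall ρ x (2 * t)) := by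
            refine measureReal_mono fun y hy => ?_
            obtain ⟨t', ht', hlt'⟩ := hcov y hy
            have := le_csSup hbdd ht'
            change ρ x y < 2 * t
            linarith
        _ ≤ C * m.real (qBall ρ x t) := hC x t ht.1
        _ ≤ C * (C ^ n * r) := by
            gcongr
            exact ht.2
        _ = _ := by ring
  -- With unbounded radii the balls of `T` exhaust `I`, so the total mass `1` is at most `C ^ n *
  -- r`.
  · have h1 : ∀ k : ℕ, m (qBall ρ x k) ≤ ENNReal.ofReal (C ^ n * r) := by
      intro k
      rw [not_bddAbove_iff] at hbdd
      obtain ⟨t, ht, hlt⟩ := hbdd k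
      rw [ENNReal.le_ofReal_iff_toReal_le (measure_ne_top _ _) (by positivity)]
      exact (measureReal_mono (qBall_mono x hlt.le)).trans ht.2
    have h2 : ⋃ k : ℕ, qBall ρ x k = Set.univ := by
      refine Set.eq_univ_of_forall fun y => ?_
      obtain ⟨k, hk⟩ := exists_nat_gt (ρ x y)
      exact Set.mem_iUnion.2 ⟨k, hk⟩
    have h3 : m (⋃ k : ℕ, qBall ρ x k) ≤ ENNReal.ofReal (C ^ n * r) := by
      rw [Monotone.measure_iUnion fun i j hij => qBall_mono x (by exact_mod_cast hij)]
      exact iSup_le h1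
    rw [h2, measure_univ] at h3
    have h4 : 1 ≤ C ^ n * r := by simpa using h3
    calc _ ≤ (1 : ℝ) := measureReal_le_one
      _ ≤ C ^ n * r := h4
      _ ≤ _ := by
        rw [mul_assoc]
        exact le_mul_of_one_le_left (by positivity) hC1

variable [BorelSpace I]

/-- The balls about `x` shrink to the null set `{x}`. -/
theorem IsHomogeneousSpace.exists_measureReal_qBall_lt (hρ : IsHomogeneousSpace ρ m)
    (hatom : ∀ x, m {x} = 0) (x : I) {ε : ℝ} (hε : 0 < ε) :
    ∃ r, 0 < r ∧ m.real (qBall ρ x r) < ε := by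
  have h1 : Tendsto (fun n : ℕ => m (qBall ρ x (1 / ((n : ℝ) + 1)))) atTop
      (𝓝 (m (⋂ n : ℕ, qBall ρ x (1 / ((n : ℝ) + 1))))) := by
    refine tendsto_measure_iInter_atTop
      (fun n => (hρ.isOpen_qBall x _ (by positivity)).measurableSet.nullMeasurableSet) ?_
      ⟨0, measure_ne_top _ _⟩
    intro i j hij
    exact qBall_mono x (Nat.one_div_le_one_div hij)
  have h2 : (⋂ n : ℕ, qBall ρ x (1 / ((n : ℝ) + 1))) ⊆ {x} := by
    intro y hy
    by_contra hne
    obtain ⟨n, hn⟩ := exists_nat_one_div_lt (hρ.quasiMetric.pos_of_ne x y (Ne.symm hne))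
    have := Set.mem_iInter.1 hy n
    exact absurd this (not_lt.2 hn.le)
  rw [measure_mono_null h2 (hatom x)] at h1
  obtain ⟨n, hn⟩ := (h1.eventually_lt_const
    (show (0 : ℝ≥0∞) < ENNReal.ofReal ε by simpa using hε)).exists
  exact ⟨_, by positivity, (ENNReal.lt_ofReal_iff_toReal_lt (measure_ne_top _ _)).1 hn⟩

theorem IsHomogeneousSpace.msDist_self (hρ : IsHomogeneousSpace ρ m) (hatom : ∀ x, m {x} = 0)
    (x : I) : msDist ρ m x x = 0 := by
  refine le_antisymm (le_of_forall_gt_imp_ge_of_dense fun ε hε => ?_) (msDist_nonneg x x)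
  obtain ⟨r, hr, h⟩ := hρ.exists_measureReal_qBall_lt hatom x hε
  have hx := hρ.quasiMetric.mem_qBall_self x hr
  exact (msDist_le_measureReal_qBall hr hx hx).trans h.le

theorem IsHomogeneousSpace.msDist_lt_mem_nhds (hρ : IsHomogeneousSpace ρ m)
    (hatom : ∀ x, m {x} = 0) (x : I) {ε : ℝ} (hε : 0 < ε) : {y | msDist ρ m x y < ε} ∈ 𝓝 x := by
  obtain ⟨r, hr, h⟩ := hρ.exists_measureReal_qBall_lt hatom x hε
  have hx := hρ.quasiMetric.mem_qBall_self x hr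
  refine mem_of_superset ((hρ.isOpen_qBall x r hr).mem_nhds hx) fun y hy => ?_
  exact (msDist_le_measureReal_qBall hr hx hy).trans_lt h

/-- Double the radius of a small `ρ`-ball about `x` until its measure first reaches `r`. The
previous ball lies in the `β`-ball and has measure at least `r / C` by doubling. If `r` is never
reached, the `β`-ball is the whole space, and `r ≤ 1` is what is needed. -/
theorem IsHomogeneousSpace.exists_measureReal_msDist_lt_ge (hρ : IsHomogeneousSpace ρ m)
    (hatom : ∀ x, m {x} = 0) :
    ∃ c : ℝ, 0 < c ∧ c ≤ 1 ∧ ∀ x r, 0 < r → r ≤ 1 →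
      c * r ≤ m.real {y | msDist ρ m x y < r} := by
  obtain ⟨C, hC1, hC⟩ := hρ.exists_doubling
  refine ⟨1 / C, by positivity, by rw [div_le_one (by positivity)]; exact hC1,
    fun x r hr hr1 => ?_⟩
  have hsub : ∀ t, 0 < t → m.real (qBall ρ x t) < r → qBall ρ x t ⊆ {y | msDist ρ m x y < r} :=
    fun t ht h y hy =>
      (msDist_le_measureReal_qBall ht (hρ.quasiMetric.mem_qBall_self x ht) hy).trans_lt h
  obtain ⟨t, ht, h⟩ := hρ.exists_measureReal_qBall_lt hatom x hr
  by_cases hall : ∀ n : ℕ, m.real (qBall ρ x (2 ^ n * t)) < r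
  · have : {y | msDist ρ m x y < r} = Set.univ := by
      refine Set.eq_univ_of_forall fun y => ?_
      obtain ⟨n, hn⟩ := pow_unbounded_of_one_lt (ρ x y / t) (one_lt_two (α := ℝ))
      rw [div_lt_iff₀ ht] at hn
      exact hsub _ (by positivity) (hall n) hn
    rw [this, probReal_univ, one_div_mul_eq_div, div_le_one (by positivity)]
    linarith
  · push Not at hall
    classical
    have hf := Nat.find_spec hall
    have hmin := fun k => Nat.find_min hall (m := k)
    generalize Nat.find hall = n at hf hmin
    cases n with
    | zero =>
      rw [pow_zero, one_mul] at hf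
      linarith
    | succ n =>
      have h1 := not_le.1 (hmin n (Nat.lt_succ_self n))
      have h2 := hC x (2 ^ n * t) (by positivity)
      rw [← mul_assoc, ← pow_succ'] at h2
      rw [one_div_mul_eq_div, div_le_iff₀ (by positivity), mul_comm]
      exact hf.trans (h2.trans (mul_le_mul_of_nonneg_left
        (measureReal_mono (hsub _ (by positivity) h1)) (by positivity)))

end MaciasSegovia

/-! ### Regular grids: uniform bounds on all levels and counting of cells -/

/-- A grid of cells adapted to a quasi-metric `β`, with `β ^ γ` comparable to a metric `d`. The
bounds hold on all levels `k ≥ 0`, and `diam_le_of_one_le` is a sharper bound for `k ≥ 1`. -/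
structure IsRegularGrid {I : Type*} [TopologicalSpace I] [MeasurableSpace I] (β d : I → I → ℝ)
    (m : Measure I) (P : ℕ → Finset (Set I)) (z : ℕ → Set I → I)
    (A γ L κ D a b Λ B η C₂ : ℝ) : Prop where
  one_le_A : 1 ≤ A
  γ_pos : 0 < γ
  L_pos : 0 < L
  κ_pos : 0 < κ
  κ_lt_one : κ < 1
  D_pos : 0 < D
  a_pos : 0 < a
  b_pos : 0 < b
  Λ_pos : 0 < Λ
  B_pos : 0 < B
  η_nonneg : 0 ≤ η
  C₂_pos : 0 < C₂
  nonneg : ∀ x y, 0 ≤ β x y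
  self_eq_zero : ∀ x, β x x = 0
  symm : ∀ x y, β x y = β y x
  quasi_triangle : ∀ x y z, β x z ≤ A * (β x y + β y z)
  dist_self : ∀ x, d x x = 0
  dist_symm : ∀ x y, d x y = d y x
  dist_triangle : ∀ x y z, d x z ≤ d x y + d y z
  dist_le : ∀ x y, d x y ≤ L * β x y ^ γ
  le_dist : ∀ x y, β x y ^ γ ≤ L * d x y
  lt_mem_nhds : ∀ x ε, 0 < ε → {y | β x y < ε} ∈ 𝓝 x
  ball_le : ∀ x r, 0 < r → m.real {y | β x y < r} ≤ Λ * r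
  measurableSet : ∀ k, ∀ Q ∈ P k, MeasurableSet Q
  aedisjoint : ∀ k, ∀ Q ∈ P k, ∀ W ∈ P k, Q ≠ W → m (Q ∩ W) = 0
  nested : ∀ k, ∀ Q ∈ P (k + 1), ∃ W ∈ P k, Q ⊆ W
  ae_existsUnique : ∀ᵐ x ∂m, ∀ k, ∃! Q, Q ∈ P k ∧ x ∈ Q
  le_measureReal : ∀ k, ∀ Q ∈ P k, a * κ ^ k ≤ m.real Q
  measureReal_le : ∀ k, ∀ Q ∈ P k, m.real Q ≤ b * κ ^ k
  center_mem : ∀ k, ∀ Q ∈ P k, z k Q ∈ Q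
  diam_le : ∀ k, ∀ Q ∈ P k, ∀ x ∈ Q, ∀ y ∈ Q, β x y ≤ D * κ ^ k
  diam_le_of_one_le : ∀ k, 1 ≤ k → ∀ Q ∈ P k, ∀ x ∈ Q, ∀ y ∈ Q, β x y ≤ C₂ * κ ^ k
  layer_le : ∀ k, ∀ Q ∈ P k, ∀ τ : ℝ, 0 < τ →
    m.real {x | x ∈ Q ∧ ∃ y, y ∉ Q ∧ β x y ≤ τ * κ ^ k} ≤ B * τ ^ η * m.real Q

theorem sum_measureReal_le_of_aedisjoint {I : Type*} [MeasurableSpace I] {m : Measure I}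
    [IsFiniteMeasure m] (F : Finset (Set I)) (E : Set I) (hF : ∀ Q ∈ F, MeasurableSet Q)
    (hd : ∀ Q ∈ F, ∀ W ∈ F, Q ≠ W → m (Q ∩ W) = 0) (hE : ∀ Q ∈ F, Q ⊆ E) :
    ∑ Q ∈ F, m.real Q ≤ m.real E := by
  have h1 : m (⋃ Q ∈ F, Q) = ∑ Q ∈ F, m Q :=
    measure_biUnion_finset₀ (f := id) (fun Q hQ W hW hne => hd Q hQ W hW hne)
      fun Q hQ => (hF Q hQ).nullMeasurableSet
  have h2 : ∑ Q ∈ F, m Q ≤ m E := by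
    rw [← h1]
    exact measure_mono (Set.iUnion₂_subset hE)
  have h3 := ENNReal.toReal_mono (measure_ne_top _ _) h2
  rwa [ENNReal.toReal_sum fun Q _ => measure_ne_top _ _] at h3

theorem IsGoodGrid.ae_existsUnique {I : Type*} [MeasurableSpace I] {m : Measure I}
    {P : ℕ → Finset (Set I)} (hP : IsGoodGrid m P) :
    ∀ᵐ x ∂m, ∀ k, ∃! Q, Q ∈ P k ∧ x ∈ Q := by
  rw [ae_all_iff]
  intro k
  have h1 : ∀ᵐ x ∂m, x ∈ ⋃ Q ∈ P k, Q := by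
    rw [ae_iff]
    exact hP.cover k
  have h2 : ∀ᵐ x ∂m, ∀ Q ∈ P k, ∀ W ∈ P k, Q ≠ W → x ∉ Q ∩ W := by
    rw [Filter.eventually_all_finset]
    intro Q hQ
    rw [Filter.eventually_all_finset]
    intro W hW
    by_cases hne : Q = W
    · simp [hne]
    · filter_upwards [measure_eq_zero_iff_ae_notMem.1 (hP.aedisjoint k Q hQ W hW hne)] with x hx _
      exact hx
  filter_upwards [h1, h2] with x hx hx'
  obtain ⟨Q, hQ, hxQ⟩ := Set.mem_iUnion₂.1 hx
  refine ⟨Q, ⟨hQ, hxQ⟩, fun W hW => ?_⟩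
  by_contra hne
  exact hx' W hW.1 Q hQ hne ⟨hW.2, hxQ⟩

/-- The cell conditions are given for `k ≥ 1` only. On level `0` the diameters are bounded by `β ≤
1`, the measure from below by that of a cell of level `1` inside, and the boundary layer by the
union of the layers of the children. -/
theorem IsHomogeneousSpace.exists_isRegularGrid {I : Type*} [TopologicalSpace I]
    [MeasurableSpace I] [BorelSpace I] {ρ : I → I → ℝ} {m : Measure I} [IsProbabilityMeasure m]
    (hρ : IsHomogeneousSpace ρ m) (hatom : ∀ x, m {x} = 0)
    {A : ℝ} (hA : IsQuasiTriangleConst (msDist ρ m) A)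
    {γ : ℝ} (hγ : IsMetricExponent (msDist ρ m) γ)
    {P : ℕ → Finset (Set I)} (hP : IsGoodGrid m P)
    {z : ℕ → Set I → I} {η c₁ C₂ c₃ C₄ κ : ℝ}
    (h : HasRegularCells (msDist ρ m) m P z η c₁ C₂ c₃ C₄ κ) (hη : 0 ≤ η) :
    ∃ L D a b Λ B, IsRegularGrid (msDist ρ m) (chainDist (msDist ρ m) γ) m P z
      A γ L κ D a b Λ B η C₂ := by
  obtain ⟨hγ0, hd, L, hL, hLd⟩ := hγ
  obtain ⟨c, hc, hc1, hlow⟩ := hρ.exists_measureReal_msDist_lt_ge hatom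
  obtain ⟨Λ, hΛ, hup⟩ := hρ.exists_measureReal_msDist_lt_le
  have hκ := h.κ_pos
  have hκ1 := h.κ_lt_one.le
  have hC₂ := h.C₂_pos
  have hc₁ := h.c₁_pos
  have hc₃ := h.c₃_pos
  have hC₄ := h.C₄_pos
  have hdiam : ∀ k, ∀ Q ∈ P k, ∀ x ∈ Q, ∀ y ∈ Q, msDist ρ m x y ≤ max C₂ 1 * κ ^ k := by
    intro k Q hQ x hx y hy
    cases k with
    | zero =>
      refine (hρ.quasiMetric.msDist_le_one x y).trans ?_
      simp
    | succ k =>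
      refine (h.diam_le _ (by omega) Q hQ x hx y hy).trans ?_
      gcongr
      exact le_max_left _ _
  -- A point of `Q` that lies in exactly one cell of each level is chosen; the parent of its cell of
  -- level `1` contains it, hence is `Q`.
  have hchild : ∀ Q ∈ P 0, ∃ Q' ∈ P 1, Q' ⊆ Q := by
    intro Q hQ
    obtain ⟨x, hx, hxQ⟩ : ∃ x, (∀ k, ∃! Q, Q ∈ P k ∧ x ∈ Q) ∧ x ∈ Q := by
      by_contra hcon
      push Not at hcon
      refine (hP.pos 0 Q hQ).ne' (measure_eq_zero_iff_ae_notMem.2 ?_)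
      filter_upwards [hP.ae_existsUnique] with x hx using hcon x hx
    obtain ⟨Q', hQ', hxQ'⟩ := (hx 1).exists
    obtain ⟨W, hW, hsub⟩ := hP.nested 0 Q' hQ'
    refine ⟨Q', hQ', ?_⟩
    rwa [(hx 0).unique ⟨hQ, hxQ⟩ ⟨hW, hsub hxQ'⟩]
  have hlow1 : ∀ k, 1 ≤ k → ∀ Q ∈ P k, c * min c₁ 1 * κ ^ k ≤ m.real Q := by
    intro k hk Q hQ
    have hr : min c₁ 1 * κ ^ k ≤ 1 :=
      mul_le_one₀ (min_le_right _ _) (by positivity) (pow_le_one₀ hκ.le hκ1)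
    rw [mul_assoc]
    refine (hlow (z k Q) _ (by positivity) hr).trans (measureReal_mono fun y hy => ?_)
    exact h.ball_subset k hk Q hQ (qBall_mono _
      (mul_le_mul_of_nonneg_right (min_le_left _ _) (by positivity)) hy)
  have hlayer : ∀ k, 1 ≤ k → ∀ Q ∈ P k, ∀ τ : ℝ, 0 < τ →
      m.real {x | x ∈ Q ∧ ∃ y, y ∉ Q ∧ msDist ρ m x y ≤ τ * κ ^ k} ≤
        C₄ * (1 / c₃) ^ η * τ ^ η * m.real Q := by
    intro k hk Q hQ τ hτ
    have h1 := h.boundary k hk Q hQ (τ / c₃) (by positivity)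
    have h2 : m {x | x ∈ Q ∧ ∃ y, y ∉ Q ∧ msDist ρ m x y ≤ τ * κ ^ k} ≤
        ENNReal.ofReal (C₄ * (τ / c₃) ^ η) * m Q := by
      refine (measure_mono ?_).trans h1
      rintro x ⟨hx, y, hy, hxy⟩
      refine ⟨hx, (iInf₂_le y hy).trans ?_⟩
      rw [mul_div_cancel₀ _ hc₃.ne']
      exact ENNReal.ofReal_le_ofReal hxy
    have h3 := ENNReal.toReal_mono (by finiteness) h2
    rw [ENNReal.toReal_mul, ENNReal.toReal_ofReal (by positivity)] at h3
    refine h3.trans (le_of_eq ?_)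
    rw [div_eq_mul_one_div, Real.mul_rpow hτ.le (by positivity)]
    change _ * m.real Q = _
    ring
  refine ⟨L, max C₂ 1, c * min c₁ 1 * κ, Λ * (2 * max C₂ 1), Λ,
    C₄ * (1 / c₃) ^ η * (1 / κ) ^ η,
    { one_le_A := hA.1
      γ_pos := hγ0
      L_pos := hL
      κ_pos := hκ
      κ_lt_one := h.κ_lt_one
      D_pos := by positivity
      a_pos := by positivity
      b_pos := by positivity
      Λ_pos := hΛ
      B_pos := by positivity
      η_nonneg := hη
      C₂_pos := hC₂
      nonneg := msDist_nonneg
      self_eq_zero := hρ.msDist_self hatom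
      symm := msDist_symm
      quasi_triangle := hA.2
      dist_self := hd.self_eq_zero
      dist_symm := hd.symm
      dist_triangle := hd.triangle
      dist_le := fun x y => by
        have := (hLd x y).1
        rwa [one_div_mul_eq_div, div_le_iff₀ hL, mul_comm] at this
      le_dist := fun x y => (hLd x y).2
      lt_mem_nhds := fun x ε hε => hρ.msDist_lt_mem_nhds hatom x hε
      ball_le := hup
      measurableSet := hP.measurableSet
      aedisjoint := hP.aedisjoint
      nested := hP.nested
      ae_existsUnique := hP.ae_existsUnique
      le_measureReal := ?_
      measureReal_le := ?_
      center_mem := h.center_mem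
      diam_le := hdiam
      diam_le_of_one_le := h.diam_le
      layer_le := ?_ }⟩
  · intro k Q hQ
    rcases Nat.eq_zero_or_pos k with rfl | hk
    · obtain ⟨Q', hQ', hsub⟩ := hchild Q hQ
      have := hlow1 1 le_rfl Q' hQ'
      rw [pow_zero, mul_one]
      rw [pow_one] at this
      exact this.trans (measureReal_mono hsub)
    · refine le_trans ?_ (hlow1 k hk Q hQ)
      exact mul_le_mul_of_nonneg_right (mul_le_of_le_one_right (by positivity) hκ1)
        (by positivity)
  · intro k Q hQ
    rw [mul_assoc]
    refine le_trans (measureReal_mono fun y hy => ?_) (hup (z k Q) _ (by positivity))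
    refine (hdiam k Q hQ _ (h.center_mem k Q hQ) y hy).trans_lt ?_
    have : 0 < max C₂ 1 * κ ^ k := by positivity
    linarith
  · intro k Q hQ τ hτ
    rcases Nat.eq_zero_or_pos k with rfl | hk
    · classical
      set F := (P 1).filter fun Q' => Q' ⊆ Q with hF
      -- A point outside `Q` is outside every child of `Q`. The distance `τ` reads `(τ / κ) * κ` at
      -- level `1`, whence the factor `(1 / κ) ^ η` in the constant.
      have hsub : {x | x ∈ Q ∧ ∃ y, y ∉ Q ∧ msDist ρ m x y ≤ τ * κ ^ 0} ≤ᵐ[m]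
          ⋃ Q' ∈ F, {x | x ∈ Q' ∧ ∃ y, y ∉ Q' ∧ msDist ρ m x y ≤ (τ / κ) * κ ^ 1} := by
        filter_upwards [hP.ae_existsUnique] with x hx
        rintro ⟨hxQ, y, hy, hxy⟩
        obtain ⟨Q', hQ', hxQ'⟩ := (hx 1).exists
        obtain ⟨W, hW, hsub⟩ := hP.nested 0 Q' hQ'
        have hWQ : W = Q := (hx 0).unique ⟨hW, hsub hxQ'⟩ ⟨hQ, hxQ⟩
        rw [hWQ] at hsub
        refine Set.mem_iUnion₂.2 ⟨Q', Finset.mem_filter.2 ⟨hQ', hsub⟩, hxQ', y,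
          fun hyQ' => hy (hsub hyQ'), ?_⟩
        rw [pow_one, div_mul_cancel₀ _ hκ.ne']
        simpa using hxy
      calc _ ≤ m.real (⋃ Q' ∈ F,
            {x | x ∈ Q' ∧ ∃ y, y ∉ Q' ∧ msDist ρ m x y ≤ (τ / κ) * κ ^ 1}) :=
            ENNReal.toReal_mono (measure_ne_top _ _) (measure_mono_ae hsub)
        _ ≤ ∑ Q' ∈ F, m.real {x | x ∈ Q' ∧ ∃ y, y ∉ Q' ∧ msDist ρ m x y ≤ (τ / κ) * κ ^ 1} :=
            measureReal_biUnion_finset_le _ _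
        _ ≤ ∑ Q' ∈ F, C₄ * (1 / c₃) ^ η * (τ / κ) ^ η * m.real Q' :=
            Finset.sum_le_sum fun Q' hQ' =>
              hlayer 1 le_rfl Q' (Finset.mem_filter.1 hQ').1 _ (by positivity)
        _ ≤ C₄ * (1 / c₃) ^ η * (τ / κ) ^ η * m.real Q := by
            rw [← Finset.mul_sum]
            refine mul_le_mul_of_nonneg_left ?_ (by positivity)
            have hFP : ∀ Q' ∈ F, Q' ∈ P 1 := fun Q' hQ' => (Finset.mem_filter.1 hQ').1
            exact sum_measureReal_le_of_aedisjoint F Q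
              (fun Q' hQ' => hP.measurableSet 1 Q' (hFP Q' hQ'))
              (fun Q' hQ' W hW => hP.aedisjoint 1 Q' (hFP Q' hQ') W (hFP W hW))
              fun Q' hQ' => (Finset.mem_filter.1 hQ').2
        _ = _ := by
            rw [div_eq_mul_one_div τ κ, Real.mul_rpow hτ.le (by positivity)]
            ring
    · refine (hlayer k hk Q hQ τ hτ).trans ?_
      have : 1 ≤ (1 / κ) ^ η := Real.one_le_rpow (by rw [le_div_iff₀ hκ]; linarith) hη
      have h0 : 0 ≤ m.real Q := measureReal_nonneg
      refine mul_le_mul_of_nonneg_right ?_ h0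
      refine mul_le_mul_of_nonneg_right ?_ (by positivity)
      exact le_mul_of_one_le_right (by positivity) this

namespace IsRegularGrid

variable {I : Type*} [TopologicalSpace I] [MeasurableSpace I] {β d : I → I → ℝ}
    {m : Measure I} {P : ℕ → Finset (Set I)} {z : ℕ → Set I → I}
    {A γ L κ D a b Λ B η C₂ : ℝ}

/-- Volume counting: the cells are essentially disjoint, lie in `E`, and each has measure at least
`a * κ ^ j`. -/
theorem ncard_mul_le [IsFiniteMeasure m] (h : IsRegularGrid β d m P z A γ L κ D a b Λ B η C₂)
    (j : ℕ) (Z : Set I → Prop) (E : Set I) (hZ : ∀ R ∈ P j, Z R → R ⊆ E) :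
    ({R ∈ (P j : Set (Set I)) | Z R}.ncard : ℝ) * (a * κ ^ j) ≤ m.real E := by
  classical
  have h1 : {R ∈ (P j : Set (Set I)) | Z R} = ((P j).filter Z : Finset (Set I)) := by
    simp
  rw [h1, Set.ncard_coe_finset, ← nsmul_eq_mul]
  refine (Finset.card_nsmul_le_sum _ (fun R => m.real R) _ fun R hR =>
    h.le_measureReal j R (Finset.mem_filter.1 hR).1).trans ?_
  exact sum_measureReal_le_of_aedisjoint _ E
    (fun R hR => h.measurableSet j R (Finset.mem_filter.1 hR).1)
    (fun R hR W hW => h.aedisjoint j R (Finset.mem_filter.1 hR).1 W (Finset.mem_filter.1 hW).1)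
    fun R hR => hZ R (Finset.mem_filter.1 hR).1 (Finset.mem_filter.1 hR).2

/-- Cells of measure comparable to `κ ^ j`: the powers of their measures are comparable too. -/
theorem exists_rpow_bounds (h : IsRegularGrid β d m P z A γ L κ D a b Λ B η C₂) (t : ℝ) :
    ∃ M : ℝ, 1 ≤ M ∧ ∀ k, ∀ Q ∈ P k,
      m.real Q ^ t ≤ M * (κ ^ t) ^ k ∧ (κ ^ t) ^ k ≤ M * m.real Q ^ t := by
  have ha := h.a_pos
  have hb := h.b_pos
  have hκ := h.κ_pos
  refine ⟨max 1 (max (max (a ^ t) (b ^ t)) (max (a ^ (-t)) (b ^ (-t)))), le_max_left _ _,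
    fun k Q hQ => ?_⟩
  set M := max 1 (max (max (a ^ t) (b ^ t)) (max (a ^ (-t)) (b ^ (-t)))) with hM
  have h1 := h.le_measureReal k Q hQ
  have h2 := h.measureReal_le k Q hQ
  have hx : 0 < m.real Q := lt_of_lt_of_le (by positivity) h1
  have hkt : (κ ^ t) ^ k = (κ ^ k) ^ t := by
    rw [← Real.rpow_natCast, ← Real.rpow_natCast, ← Real.rpow_mul hκ.le, ← Real.rpow_mul hκ.le,
      mul_comm]
  have hMa : a ^ t ≤ M := by simp [hM]
  have hMb : b ^ t ≤ M := by simp [hM]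
  have hMa' : a ^ (-t) ≤ M := by simp [hM]
  have hMb' : b ^ (-t) ≤ M := by simp [hM]
  have key : ∀ c : ℝ, 0 < c → c ^ (-t) * (c ^ t * (κ ^ k) ^ t) = (κ ^ k) ^ t := by
    intro c hc
    rw [← mul_assoc, ← Real.rpow_add hc]
    simp
  rw [hkt]
  rcases le_total 0 t with ht | ht
  · constructor
    · calc _ ≤ (b * κ ^ k) ^ t := by gcongr
        _ = b ^ t * (κ ^ k) ^ t := Real.mul_rpow hb.le (by positivity)
        _ ≤ _ := by gcongr
    · rw [← key a ha, ← Real.mul_rpow ha.le (by positivity)]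
      gcongr
  · constructor
    · calc _ ≤ (a * κ ^ k) ^ t := Real.rpow_le_rpow_of_nonpos (by positivity) h1 ht
        _ = a ^ t * (κ ^ k) ^ t := Real.mul_rpow ha.le (by positivity)
        _ ≤ _ := by gcongr
    · rw [← key b hb, ← Real.mul_rpow hb.le (by positivity)]
      have := Real.rpow_le_rpow_of_nonpos hx h2 ht
      gcongr

end IsRegularGrid

/-- `E` is replaced by a measurable hull, since the boundary layers to which this is applied are not
known to be measurable. -/
theorem eLpNorm_le_of_bound_of_support {I : Type*} [MeasurableSpace I] {m : Measure I}
    [IsFiniteMeasure m] {p : ℝ} (hp : 1 ≤ p) {f : I → ℂ} {c : ℝ} (hc : 0 ≤ c) {E : Set I}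
    (h : ∀ᵐ x ∂m, ‖f x‖ ≤ c ∧ (f x ≠ 0 → x ∈ E)) :
    eLpNorm f (ENNReal.ofReal p) m ≤ ENNReal.ofReal (c * m.real E ^ (1 / p)) := by
  have hp0 : 0 < p := by linarith
  calc _ ≤ eLpNorm ((toMeasurable m E).indicator fun _ => c) (ENNReal.ofReal p) m := by
        refine eLpNorm_mono_ae_real ?_
        filter_upwards [h] with x hx
        by_cases hfx : f x = 0
        · rw [hfx, norm_zero]
          exact Set.indicator_nonneg (fun _ _ => hc) x
        · rw [Set.indicator_of_mem (subset_toMeasurable m E (hx.2 hfx))]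
          exact hx.1
    _ = _ := by
        rw [eLpNorm_indicator_const (measurableSet_toMeasurable _ _) (by simpa using hp0)
          ENNReal.ofReal_ne_top, measure_toMeasurable, ENNReal.toReal_ofReal hp0.le,
          ENNReal.ofReal_mul hc, ← ENNReal.ofReal_rpow_of_nonneg measureReal_nonneg (by positivity),
          ofReal_measureReal, Real.enorm_of_nonneg hc]

/-! ### From Han–Lu–Yang blocks to Souza atoms -/

/-- The increment from level `j - 1` to level `j`, on the cell `R` of level `j`, of the piecewise
constant approximations of `f` by its values at the centres, started at level `k`. -/
def centerIncrement {I : Type*} (z : ℕ → Set I → I) (par : ℕ → Set I → Set I) (f : I → ℂ)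
    (k j : ℕ) (R : Set I) : ℂ :=
  if j = k then f (z j R) else f (z j R) - f (z (j - 1) (par (j - 1) R))

/-- The piecewise constant approximation of `f` by its values at the centres of level `n`. -/
noncomputable def centerApprox {I : Type*} (P : ℕ → Finset (Set I)) (z : ℕ → Set I → I)
    (f : I → ℂ) (n : ℕ) (x : I) : ℂ :=
  ∑ R ∈ P n, R.indicator (fun _ => f (z n R)) x

theorem sum_indicator_eq_of_existsUnique {I : Type*} {P : ℕ → Finset (Set I)}
    {x : I} {n : ℕ} (hx : ∃! Q, Q ∈ P n ∧ x ∈ Q) {R : Set I} (hR : R ∈ P n) (hxR : x ∈ R)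
    (F : Set I → ℂ) : ∑ R ∈ P n, R.indicator (fun _ => F R) x = F R := by
  rw [Finset.sum_eq_single R]
  · rw [Set.indicator_of_mem hxR]
  · intro W hW hne
    rw [Set.indicator_of_notMem]
    exact fun hxW => hne (hx.unique ⟨hW, hxW⟩ ⟨hR, hxR⟩)
  · exact fun hR' => absurd hR hR'

namespace IsRegularGrid

variable {I : Type*} [TopologicalSpace I] [MeasurableSpace I] {β d : I → I → ℝ}
    {m : Measure I} {P : ℕ → Finset (Set I)} {z : ℕ → Set I → I}
    {A γ L κ D a b Λ B η C₂ : ℝ}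

/-- This supplies the measurability of blocks and cutoffs; it holds because `β`-balls are
neighbourhoods of their centres. -/
theorem continuous_of_holder (h : IsRegularGrid β d m P z A γ L κ D a b Λ B η C₂)
    {E : Type*} [NormedAddCommGroup E] {f : I → E} {C : ℝ}
    (hf : ∀ x y, ‖f x - f y‖ ≤ C * β x y ^ γ) : Continuous f := by
  refine continuous_iff_continuousAt.2 fun x => Metric.tendsto_nhds.2 fun ε hε => ?_
  have hγ := h.γ_pos
  set r : ℝ := (ε / (|C| + 1)) ^ (1 / γ) with hr
  filter_upwards [h.lt_mem_nhds x r (by positivity)] with y hy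
  rw [dist_eq_norm, norm_sub_rev]
  calc _ ≤ C * β x y ^ γ := hf x y
    _ ≤ (|C| + 1) * β x y ^ γ := by
        have := h.nonneg x y
        gcongr
        linarith [le_abs_self C]
    _ < (|C| + 1) * r ^ γ := by
        have : β x y < r := hy
        have := h.nonneg x y
        gcongr
    _ = ε := by
        rw [hr, ← Real.rpow_mul (by positivity), one_div_mul_cancel hγ.ne', Real.rpow_one]
        field_simp

/-- Bounded overlap: these cells lie in the ball of centre `x` and radius `A * (r + D) * κ ^ k`,
whose measure is comparable at most to that of one cell. -/
theorem ncard_centers_le [IsFiniteMeasure m] (h : IsRegularGrid β d m P z A γ L κ D a b Λ B η C₂)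
    {r : ℝ} (hr : 0 < r) (k : ℕ) (Z : Set I → Prop) (x : I)
    (hZ : ∀ Q ∈ P k, Z Q → β (z k Q) x < r * κ ^ k) :
    ({Q ∈ (P k : Set (Set I)) | Z Q}.ncard : ℝ) ≤ Λ * (A * (r + D)) / a := by
  have hκ := h.κ_pos
  have ha := h.a_pos
  have hA : 0 < A := zero_lt_one.trans_le h.one_le_A
  have hD := h.D_pos
  have h1 := h.ncard_mul_le k Z {y | β x y < A * (r + D) * κ ^ k} ?_
  · have h2 := h1.trans (h.ball_le x _ (by positivity))
    rw [le_div_iff₀ ha]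
    have hκk : 0 < κ ^ k := by positivity
    refine le_of_mul_le_mul_right ?_ hκk
    calc _ = _ := by ring
      _ ≤ _ := h2
      _ = _ := by ring
  · intro Q hQ hZQ y hy
    calc β x y ≤ A * (β x (z k Q) + β (z k Q) y) := h.quasi_triangle _ _ _
      _ < A * (r * κ ^ k + D * κ ^ k) := by
          rw [h.symm x]
          refine mul_lt_mul_of_pos_left ?_ hA
          exact add_lt_add_of_lt_of_le (hZ Q hQ hZQ) (h.diam_le k Q hQ _ (h.center_mem k Q hQ) y hy)
      _ = _ := by ring

theorem mem_nhds_ball_of_mem_cell (h : IsRegularGrid β d m P z A γ L κ D a b Λ B η C₂)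
    {k n : ℕ} (hkn : k ≤ n) {W : Set I} (hW : W ∈ P n) {w x y : I} {r : ℝ} (hx : x ∈ W)
    (hy : y ∈ W) (hwx : β w x < r * κ ^ k) : β w y < A * (r + D) * κ ^ k := by
  have hA : 0 < A := zero_lt_one.trans_le h.one_le_A
  calc β w y ≤ A * (β w x + β x y) := h.quasi_triangle _ _ _
    _ < A * (r * κ ^ k + D * κ ^ k) := by
        refine mul_lt_mul_of_pos_left (add_lt_add_of_lt_of_le hwx ?_) hA
        refine (h.diam_le n W hW _ hx y hy).trans ?_
        exact mul_le_mul_of_nonneg_left (pow_le_pow_of_le_one h.κ_pos.le h.κ_lt_one.le hkn)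
          h.D_pos.le
    _ = _ := by ring

/-- The exponent `n + 1`, paid for by `κ ^ (-γ)`, anticipates the uses: increments of level `j` and
remainders of index `N` compare two values inside a cell of level `j - 1`, respectively `N - 1`. -/
theorem holder_bound (h : IsRegularGrid β d m P z A γ L κ D a b Λ B η C₂) {s p R M : ℝ}
    (hM : ∀ k, ∀ Q ∈ P k, m.real Q ^ (s - 1 / p - γ) ≤ M * (κ ^ (s - 1 / p - γ)) ^ k)
    {f : I → ℂ} {k : ℕ} {Q : Set I} (hQ : Q ∈ P k)
    (hf : IsHLYBlock β m γ s p Q (z k Q) R f) {n : ℕ} {W : Set I} (hW : W ∈ P n) {x y : I}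
    (hx : x ∈ W) (hy : y ∈ W) :
    ‖f x - f y‖ ≤ M * D ^ γ * κ ^ (-γ) * ((κ ^ (s - 1 / p - γ)) ^ k * (κ ^ γ) ^ (n + 1)) := by
  have hκ := h.κ_pos
  have hγ := h.γ_pos
  have hD := h.D_pos
  have h0 := h.nonneg x y
  have h1 : (κ ^ γ) ^ n = κ ^ (-γ) * (κ ^ γ) ^ (n + 1) := by
    rw [pow_succ', ← mul_assoc, ← Real.rpow_add hκ]
    simp
  calc _ ≤ m.real Q ^ (s - 1 / p - γ) * β x y ^ γ := hf.holder x y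
    _ ≤ M * (κ ^ (s - 1 / p - γ)) ^ k * (D * κ ^ n) ^ γ := by
        have := hM k Q hQ
        have h2 : 0 ≤ m.real Q ^ (s - 1 / p - γ) := by positivity
        refine mul_le_mul this ?_ (by positivity) (h2.trans this)
        exact Real.rpow_le_rpow h0 (h.diam_le n W hW x hx y hy) hγ.le
    _ = M * (κ ^ (s - 1 / p - γ)) ^ k * (D ^ γ * (κ ^ γ) ^ n) := by
        rw [Real.mul_rpow hD.le (by positivity), Real.rpow_pow_comm hκ.le γ n]
    _ = _ := by
        rw [h1]
        ring

end IsRegularGrid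

/-- `u` is `t` times (a multiple of modulus at most one of) the Souza atom on `Q`. -/
def IsSouzaMultiple {I : Type*} [MeasurableSpace I] (m : Measure I) (s p : ℝ) (_k : ℕ) (Q : Set I)
    (t : ℝ≥0) (u : I → ℂ) : Prop :=
  ∃ b : ℂ, ‖b‖ ≤ t ∧ u = b • souzaAtom m s p Q

theorem isAtomGauge_isSouzaMultiple {I : Type*} [MeasurableSpace I] (m : Measure I) (s p : ℝ) :
    IsAtomGauge (IsSouzaMultiple m s p) where
  zero := fun _ _ => ⟨0, by simp, by simp⟩
  add := by
    rintro _ Q t t' _ _ ⟨b, hb, rfl⟩ ⟨b', hb', rfl⟩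
    exact ⟨b + b', (norm_add_le _ _).trans (by push_cast; gcongr), (add_smul _ _ _).symm⟩
  smul := by
    rintro _ Q t _ w ⟨b, hb, rfl⟩
    refine ⟨w * b, ?_, (mul_smul _ _ _).symm⟩
    rw [norm_mul]
    push_cast
    gcongr

namespace IsRegularGrid

variable {I : Type*} [TopologicalSpace I] [MeasurableSpace I] {β d : I → I → ℝ}
    {m : Measure I} {P : ℕ → Finset (Set I)} {z : ℕ → Set I → I}
    {A γ L κ D a b Λ B η C₂ : ℝ}

theorem measureReal_pos (h : IsRegularGrid β d m P z A γ L κ D a b Λ B η C₂) {k : ℕ} {Q : Set I}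
    (hQ : Q ∈ P k) : 0 < m.real Q := by
  have hκ := h.κ_pos
  have ha := h.a_pos
  exact lt_of_lt_of_le (by positivity) (h.le_measureReal k Q hQ)

theorem exists_parent (h : IsRegularGrid β d m P z A γ L κ D a b Λ B η C₂) :
    ∃ par : ℕ → Set I → Set I, ∀ k, ∀ Q ∈ P (k + 1), par k Q ∈ P k ∧ Q ⊆ par k Q := by
  choose! par hpar using h.nested
  exact ⟨par, hpar⟩

variable {s p R M : ℝ} {par : ℕ → Set I → Set I}

theorem norm_centerIncrement_le (h : IsRegularGrid β d m P z A γ L κ D a b Λ B η C₂)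
    (hpar : ∀ k, ∀ Q ∈ P (k + 1), par k Q ∈ P k ∧ Q ⊆ par k Q)
    (hM : ∀ k, ∀ Q ∈ P k, m.real Q ^ (s - 1 / p - γ) ≤ M * (κ ^ (s - 1 / p - γ)) ^ k)
    {M' : ℝ} (hM' : ∀ k, ∀ Q ∈ P k, m.real Q ^ (s - 1 / p) ≤ M' * (κ ^ (s - 1 / p)) ^ k)
    {f : I → ℂ} {k : ℕ} {Q : Set I} (hQ : Q ∈ P k)
    (hf : IsHLYBlock β m γ s p Q (z k Q) R f) {j : ℕ} (hkj : k ≤ j) {W : Set I} (hW : W ∈ P j) :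
    ‖centerIncrement z par f k j W‖ ≤ max (M * D ^ γ * κ ^ (-γ)) M' *
      ((κ ^ (s - 1 / p - γ)) ^ k * (κ ^ γ) ^ j) := by
  have hκ := h.κ_pos
  unfold centerIncrement
  split_ifs with hjk
  · subst hjk
    rw [← mul_pow, ← Real.rpow_add hκ, sub_add_cancel]
    refine (hf.bound _).trans ((hM' j Q hQ).trans ?_)
    gcongr
    exact le_max_right _ _
  · obtain ⟨n, rfl⟩ : ∃ n, j = n + 1 := ⟨j - 1, by omega⟩
    obtain ⟨h1, h2⟩ := hpar n W hW
    refine (h.holder_bound hM hQ hf h1 (h2 (h.center_mem _ W hW)) (h.center_mem _ _ h1)).trans ?_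
    gcongr
    exact le_max_left _ _

theorem _root_.IsHLYBlock.lt_of_ne_zero {w : I} {Q : Set I} {r : ℝ} {f : I → ℂ}
    (hf : IsHLYBlock β m γ s p Q w r f) {x : I} (hx : f x ≠ 0) : β w x < r :=
  hf.tsupport_subset (subset_tsupport f hx)

/-- The block is nonzero at the centre of `W` or of its parent, so that cell meets the supporting
ball, and it sticks out by no more than its own diameter. -/
theorem subset_of_centerIncrement_ne_zero (h : IsRegularGrid β d m P z A γ L κ D a b Λ B η C₂)
    (hpar : ∀ k, ∀ Q ∈ P (k + 1), par k Q ∈ P k ∧ Q ⊆ par k Q)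
    {f : I → ℂ} {k : ℕ} {Q : Set I}
    (hf : IsHLYBlock β m γ s p Q (z k Q) (R * κ ^ k) f) {j : ℕ} (hkj : k ≤ j) {W : Set I}
    (hW : W ∈ P j) (hne : centerIncrement z par f k j W ≠ 0) {y : I} (hy : y ∈ W) :
    β (z k Q) y < A * (R + D) * κ ^ k := by
  unfold centerIncrement at hne
  split_ifs at hne with hjk
  · exact h.mem_nhds_ball_of_mem_cell hkj hW (h.center_mem _ W hW) hy (hf.lt_of_ne_zero hne)
  · obtain ⟨n, rfl⟩ : ∃ n, j = n + 1 := ⟨j - 1, by omega⟩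
    obtain ⟨h1, h2⟩ := hpar n W hW
    have hkn : k ≤ n := by omega
    by_cases h3 : f (z (n + 1) W) = 0
    · have h4 : f (z n (par n W)) ≠ 0 := by
        intro h4
        simp [h3, h4] at hne
      exact h.mem_nhds_ball_of_mem_cell hkn h1 (h.center_mem _ _ h1) (h2 hy) (hf.lt_of_ne_zero h4)
    · exact h.mem_nhds_ball_of_mem_cell hkn h1 (h2 (h.center_mem _ W hW)) (h2 hy)
        (hf.lt_of_ne_zero h3)

theorem centerApprox_sub (h : IsRegularGrid β d m P z A γ L κ D a b Λ B η C₂)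
    (hpar : ∀ k, ∀ Q ∈ P (k + 1), par k Q ∈ P k ∧ Q ⊆ par k Q) (f : I → ℂ) {k j : ℕ}
    (hkj : k ≤ j) : ∀ᵐ x ∂m,
      centerApprox P z f j x - (if j ≤ k then 0 else centerApprox P z f (j - 1) x) =
      ∑ W ∈ P j, W.indicator (fun _ => centerIncrement z par f k j W) x := by
  filter_upwards [h.ae_existsUnique] with x hx
  obtain ⟨W, hW, hxW⟩ := (hx j).exists
  rw [sum_indicator_eq_of_existsUnique (hx j) hW hxW, centerApprox,
    sum_indicator_eq_of_existsUnique (hx j) hW hxW fun W => f (z j W)]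
  unfold centerIncrement
  by_cases hjk : j = k
  · simp [hjk]
  · rw [if_neg (by omega), if_neg hjk]
    obtain ⟨n, rfl⟩ : ∃ n, j = n + 1 := ⟨j - 1, by omega⟩
    obtain ⟨h1, h2⟩ := hpar n W hW
    rw [Nat.add_sub_cancel, centerApprox,
      sum_indicator_eq_of_existsUnique (hx n) h1 (h2 hxW) fun W => f (z n W)]

theorem sub_centerApprox_bound (h : IsRegularGrid β d m P z A γ L κ D a b Λ B η C₂)
    (hM : ∀ k, ∀ Q ∈ P k, m.real Q ^ (s - 1 / p - γ) ≤ M * (κ ^ (s - 1 / p - γ)) ^ k)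
    {M' : ℝ} (hM' : ∀ k, ∀ Q ∈ P k, m.real Q ^ (s - 1 / p) ≤ M' * (κ ^ (s - 1 / p)) ^ k)
    (hR : 0 < R) {f : ℕ → Set I → I → ℂ} {N : ℕ} {k : ℕ}
    (hf : ∀ Q ∈ P k, IsHLYBlock β m γ s p Q (z k Q) (R * κ ^ k) (f k Q)) (hkN : k ≤ N) :
    ∀ᵐ x ∂m, ∀ Q ∈ P k,
      ‖f k Q x - (if N ≤ k then 0 else centerApprox P z (f k Q) (N - 1) x)‖ ≤
        max (M * D ^ γ * κ ^ (-γ)) M' * ((κ ^ (s - 1 / p - γ)) ^ k * (κ ^ γ) ^ N) ∧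
      (f k Q x - (if N ≤ k then 0 else centerApprox P z (f k Q) (N - 1) x) ≠ 0 →
        β (z k Q) x < A * (R + D) * κ ^ k) := by
  have hκ := h.κ_pos
  filter_upwards [h.ae_existsUnique] with x hx Q hQ
  have hf := hf Q hQ
  by_cases hNk : N ≤ k
  · have : N = k := le_antisymm hNk hkN
    subst this
    rw [if_pos le_rfl, sub_zero]
    constructor
    · rw [← mul_pow, ← Real.rpow_add hκ, sub_add_cancel]
      refine (hf.bound _).trans ((hM' N Q hQ).trans ?_)
      gcongr
      exact le_max_right _ _
    · intro hne
      refine (hf.lt_of_ne_zero hne).trans_le ?_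
      have := h.one_le_A
      have := h.D_pos
      gcongr
      nlinarith
  · rw [if_neg hNk]
    obtain ⟨n, rfl⟩ : ∃ n, N = n + 1 := ⟨N - 1, by omega⟩
    obtain ⟨W, hW, hxW⟩ := (hx n).exists
    rw [Nat.add_sub_cancel, centerApprox,
      sum_indicator_eq_of_existsUnique (hx n) hW hxW fun W => f k Q (z n W)]
    have hzW := h.center_mem n W hW
    constructor
    · refine (h.holder_bound hM hQ hf hW hxW hzW).trans ?_
      gcongr
      exact le_max_left _ _
    · intro hne
      by_cases h3 : f k Q x = 0
      · have h4 : f k Q (z n W) ≠ 0 := by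
          intro h4
          simp [h3, h4] at hne
        exact h.mem_nhds_ball_of_mem_cell (by omega) hW hzW hxW (hf.lt_of_ne_zero h4)
      · exact h.mem_nhds_ball_of_mem_cell (by omega) hW hxW hxW (hf.lt_of_ne_zero h3)

/-- `μ` is the decay of the increments relative to the height of a Souza atom of level `j`, `ν` the
growth of the number of cells of level `j` in a ball of radius `≲ κ ^ k`, and `θ` the decay of the
remainders in `L^p`. -/
theorem exists_transfer_souza [BorelSpace I] [IsFiniteMeasure m]
    (h : IsRegularGrid β d m P z A γ L κ D a b Λ B η C₂) (hp : 1 ≤ p) (hsγ : s < γ)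
    (hR : 0 < R) {μ ν θ : ℝ≥0} (hμ : (μ : ℝ) = κ ^ (γ + 1 / p - s)) (hν : (ν : ℝ) = κ⁻¹)
    (hθ : (θ : ℝ) = κ ^ s) :
    ∃ Γ : ℝ≥0, 1 ≤ Γ ∧ ∀ f : ℕ → Set I → I → ℂ,
      (∀ k, ∀ Q ∈ P k, IsHLYBlock β m γ s p Q (z k Q) (R * κ ^ k) (f k Q)) →
      ∃ S u, IsAtomicTransfer m P p f S u (IsSouzaMultiple m s p) Γ μ ν θ := by
  have hκ := h.κ_pos
  have ha := h.a_pos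
  have hΛ := h.Λ_pos
  have hD := h.D_pos
  have hA : 0 < A := zero_lt_one.trans_le h.one_le_A
  have hp0 : 0 < p := by linarith
  obtain ⟨M, hM1, hM⟩ := h.exists_rpow_bounds (s - 1 / p - γ)
  obtain ⟨M', hM'1, hM'⟩ := h.exists_rpow_bounds (s - 1 / p)
  obtain ⟨par, hpar⟩ := h.exists_parent
  set X : ℝ := max (M * D ^ γ * κ ^ (-γ)) M' with hX
  have hX0 : 0 < X := lt_max_of_lt_right (by linarith)
  set r : ℝ := A * (R + D) with hr
  have hr0 : 0 < r := by positivity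
  set Γ₁ : ℝ := Λ * r / a with hΓ₁
  set Γ₂ : ℝ := Λ * (A * (r + D)) / a with hΓ₂
  set Γ₃ : ℝ := X * M' with hΓ₃
  set Γ₄ : ℝ := X * (Λ * r) ^ (1 / p) with hΓ₄
  have hΓ₁0 : 0 < Γ₁ := by positivity
  have hΓ₂0 : 0 < Γ₂ := by positivity
  have hΓ₃0 : 0 < Γ₃ := by positivity
  have hΓ₄0 : 0 < Γ₄ := by positivity
  obtain ⟨Γ, hΓ⟩ : ∃ Γ : ℝ≥0, (Γ : ℝ) = 1 + Γ₁ + Γ₂ + Γ₃ + Γ₄ := ⟨⟨_, by positivity⟩, rfl⟩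
  refine ⟨Γ, ?_, fun f hf => ?_⟩
  · rw [← NNReal.coe_le_coe, hΓ, NNReal.coe_one]
    linarith
  have hfc : ∀ k, ∀ Q ∈ P k, Continuous (f k Q) := fun k Q hQ =>
    h.continuous_of_holder (hf k Q hQ).holder
  have hT : ∀ k Q n, Measurable (centerApprox P z (f k Q) n) := fun k Q n =>
    Finset.measurable_fun_sum _ fun W hW => measurable_const.indicator (h.measurableSet n W hW)
  have hkey : ∀ k N, k ≤ N → _ := fun k N hkN =>
    h.sub_centerApprox_bound (fun k Q hQ => (hM k Q hQ).1) (fun k Q hQ => (hM' k Q hQ).1) hR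
      (fun Q hQ => hf k Q hQ) hkN
  -- The index is shifted: `S k Q N` uses the centres of level `N - 1`, so that the increment from
  -- `j` to `j + 1` is, almost everywhere, constant on cells of level `j`.
  refine ⟨fun k Q N x => if N ≤ k then 0 else centerApprox P z (f k Q) (N - 1) x,
    fun k Q j W => W.indicator fun _ => centerIncrement z par (f k Q) k j W,
    { aestronglyMeasurable := fun k Q hQ => (hfc k Q hQ).aestronglyMeasurable
      aestronglyMeasurable_approx := fun k Q hQ N => ?_
      eq_zero := fun k Q hQ N hN => ?_
      sub_eq := fun k Q hQ j hkj => ?_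
      gauge := fun k Q hQ j hkj W hW => ?_
      card_target := fun k Q hQ j hkj => ?_
      card_source := fun j W hW k hkj => ?_
      approx := fun k Q hQ N hkN => ?_
      overlap := fun k N hkN => ?_ }⟩
  · by_cases hN : N ≤ k
    · simpa [hN] using aestronglyMeasurable_const
    · simpa [hN] using (hT k Q (N - 1)).aestronglyMeasurable
  · ext x
    simp [hN]
  · filter_upwards [h.centerApprox_sub hpar (f k Q) hkj] with x hx
    rw [← hx, if_neg (by omega), Nat.add_sub_cancel]
  · have hpos := h.measureReal_pos hW
    have hne : ((m.real W ^ (s - 1 / p) : ℝ) : ℂ) ≠ 0 :=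
      Complex.ofReal_ne_zero.2 (Real.rpow_pos_of_pos hpos _).ne'
    refine ⟨centerIncrement z par (f k Q) k j W / ((m.real W ^ (s - 1 / p) : ℝ) : ℂ), ?_, ?_⟩
    · have h1 := h.norm_centerIncrement_le hpar (fun k Q hQ => (hM k Q hQ).1)
        (fun k Q hQ => (hM' k Q hQ).1) hQ (hf k Q hQ) hkj hW
      rw [norm_div, Complex.norm_real, Real.norm_of_nonneg (by positivity),
        div_le_iff₀ (by positivity)]
      push_cast
      rw [hΓ, hμ]
      have h2 := (hM' j W hW).2
      have h3 : (κ ^ (s - 1 / p - γ)) ^ k * (κ ^ γ) ^ j =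
          (κ ^ (γ + 1 / p - s)) ^ (j - k) * (κ ^ (s - 1 / p)) ^ j := by
        obtain ⟨i, rfl⟩ := Nat.exists_eq_add_of_le hkj
        rw [Nat.add_sub_cancel_left, pow_add, pow_add, ← mul_assoc, ← mul_pow, ← Real.rpow_add hκ,
          mul_left_comm, ← mul_pow, ← Real.rpow_add hκ]
        congr 3 <;> ring
      calc _ ≤ X * ((κ ^ (γ + 1 / p - s)) ^ (j - k) * (κ ^ (s - 1 / p)) ^ j) := h3 ▸ h1
        _ ≤ X * ((κ ^ (γ + 1 / p - s)) ^ (j - k) * (M' * m.real W ^ (s - 1 / p))) := by gcongr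
        _ = Γ₃ * (κ ^ (γ + 1 / p - s)) ^ (j - k) * m.real W ^ (s - 1 / p) := by
            rw [hΓ₃]
            ring
        _ ≤ _ := by
            gcongr
            linarith
    · ext x
      by_cases hx : x ∈ W
      · simp only [souzaAtom, Pi.smul_apply, Set.indicator_of_mem hx, smul_eq_mul]
        rw [div_mul_cancel₀ _ hne]
      · simp [souzaAtom, hx]
  · rw [← NNReal.coe_le_coe]
    push_cast
    rw [hΓ, hν]
    have h1 := h.ncard_mul_le j
      (fun W => W.indicator (fun _ => centerIncrement z par (f k Q) k j W) ≠ 0)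
      {y | β (z k Q) y < r * κ ^ k} (fun W hW hne y hy => by
        refine h.subset_of_centerIncrement_ne_zero hpar (hf k Q hQ) hkj hW ?_ hy
        intro h0
        exact hne (by simp only [h0]; exact Set.indicator_zero _ W))
    have h2 := h1.trans (h.ball_le _ _ (by positivity))
    calc _ ≤ Λ * (r * κ ^ k) / (a * κ ^ j) := (le_div_iff₀ (by positivity)).2 h2
      _ = Γ₁ * κ⁻¹ ^ (j - k) := by
          obtain ⟨i, rfl⟩ := Nat.exists_eq_add_of_le hkj
          rw [hΓ₁, Nat.add_sub_cancel_left, pow_add, inv_pow]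
          field_simp
      _ ≤ _ := by
          gcongr
          linarith
  · rw [← NNReal.coe_le_coe]
    push_cast
    rw [hΓ]
    refine (h.ncard_centers_le hr0 k _ (z j W) fun Q hQ hne => ?_).trans (?_ : Γ₂ ≤ _)
    · refine h.subset_of_centerIncrement_ne_zero hpar (hf k Q hQ) hkj hW ?_ (h.center_mem j W hW)
      intro h0
      exact hne (by simp only [h0]; exact Set.indicator_zero _ W)
    · linarith
  · refine (eLpNorm_le_of_bound_of_support hp (E := {y | β (z k Q) y < r * κ ^ k})
      (c := X * ((κ ^ (s - 1 / p - γ)) ^ k * (κ ^ γ) ^ N)) (by positivity) ?_).trans ?_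
    · filter_upwards [hkey k N hkN] with x hx using hx Q hQ
    -- The left side is `κ ^ (s k + γ (N - k))`, and `s ≤ γ`.
    · have h1 : (κ ^ (s - 1 / p - γ)) ^ k * (κ ^ γ) ^ N * (κ ^ k) ^ (1 / p) ≤ (κ ^ s) ^ N := by
        obtain ⟨i, rfl⟩ := Nat.exists_eq_add_of_le hkN
        rw [← Real.rpow_pow_comm hκ.le, mul_right_comm, ← mul_pow, ← Real.rpow_add hκ, pow_add,
          pow_add, ← mul_assoc, ← mul_pow, ← Real.rpow_add hκ]
        have h2 : s - 1 / p - γ + 1 / p + γ = s := by ring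
        rw [h2]
        gcongr ?_ * ?_ ^ i
        exact Real.rpow_le_rpow_of_exponent_ge hκ h.κ_lt_one.le hsγ.le
      have h2 : (Γ : ℝ≥0∞) * (θ : ℝ≥0∞) ^ N =
          ENNReal.ofReal ((1 + Γ₁ + Γ₂ + Γ₃ + Γ₄) * (κ ^ s) ^ N) := by
        rw [ENNReal.ofReal_mul (by positivity), ENNReal.ofReal_pow (by positivity), ← hθ,
          ← hΓ, ENNReal.ofReal_coe_nnreal, ENNReal.ofReal_coe_nnreal]
      rw [h2]
      refine ENNReal.ofReal_le_ofReal ?_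
      calc _ ≤ X * ((κ ^ (s - 1 / p - γ)) ^ k * (κ ^ γ) ^ N) * (Λ * (r * κ ^ k)) ^ (1 / p) := by
            gcongr
            exact h.ball_le _ _ (by positivity)
        _ = Γ₄ * ((κ ^ (s - 1 / p - γ)) ^ k * (κ ^ γ) ^ N * (κ ^ k) ^ (1 / p)) := by
            rw [← mul_assoc Λ, Real.mul_rpow (by positivity) (by positivity), hΓ₄]
            ring
        _ ≤ Γ₄ * (κ ^ s) ^ N := by gcongr
        _ ≤ _ := by
            gcongr
            linarith
  · filter_upwards [hkey k N hkN] with x hx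
    rw [← NNReal.coe_le_coe]
    push_cast
    rw [hΓ]
    refine (h.ncard_centers_le hr0 k _ x fun Q hQ hne => (hx Q hQ).2 hne).trans (?_ : Γ₂ ≤ _)
    linarith

end IsRegularGrid

/-! ### Lipschitz cutoffs, partitions of unity, and the gauge of blocks -/

/-- The function is the infimal convolution of the indicator of `Eᶜ` with `d / τ`. Unlike a
truncated distance to `E` defined by a real infimum, it needs no separate treatment of an empty `E`.
-/
theorem exists_lipschitz_cutoff {I : Type*} {d : I → I → ℝ} (h0 : ∀ x, d x x = 0)
    (hsymm : ∀ x y, d x y = d y x) (htri : ∀ x y z, d x z ≤ d x y + d y z) (E : Set I) {τ : ℝ}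
    (hτ : 0 < τ) :
    ∃ φ : I → ℝ, (∀ x, 0 ≤ φ x) ∧ (∀ x, φ x ≤ 1) ∧ (∀ x y, |φ x - φ y| ≤ 1 / τ * d x y) ∧
      (∀ x ∈ E, φ x = 0) ∧ ∀ x, φ x < 1 → ∃ y ∈ E, d x y < τ := by
  have hd : ∀ x y, 0 ≤ d x y := fun x y => by
    have := htri x y x
    rw [h0, hsymm y x] at this
    linarith
  set F : I → I → ℝ := fun x y => Eᶜ.indicator 1 y + d x y / τ with hF
  have hF0 : ∀ x y, 0 ≤ F x y := fun x y => by
    have : 0 ≤ Eᶜ.indicator (1 : I → ℝ) y := Set.indicator_nonneg (fun _ _ => zero_le_one) y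
    have := hd x y
    positivity
  have hbdd : ∀ x, BddBelow (Set.range (F x)) := fun x => ⟨0, by rintro _ ⟨y, rfl⟩; exact hF0 x y⟩
  have hle : ∀ x y, (⨅ w, F x w) ≤ (⨅ w, F y w) + 1 / τ * d x y := by
    intro x y
    have : Nonempty I := ⟨x⟩
    rw [← sub_le_iff_le_add]
    refine le_ciInf fun w => ?_
    rw [sub_le_iff_le_add]
    refine (ciInf_le (hbdd x) w).trans ?_
    simp only [hF]
    have : d x w / τ ≤ d y w / τ + 1 / τ * d x y := by
      rw [one_div_mul_eq_div, ← add_div, add_comm]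
      gcongr
      exact htri x y w
    linarith
  refine ⟨fun x => ⨅ y, F x y, fun x => Real.iInf_nonneg (hF0 x), fun x => ?_, fun x y => ?_,
    fun x hx => ?_, fun x hx => ?_⟩
  · refine (ciInf_le (hbdd x) x).trans ?_
    simp only [hF, h0, zero_div, add_zero]
    exact Set.indicator_apply_le' (fun _ => le_rfl) fun _ => zero_le_one
  · rw [abs_sub_le_iff]
    have h1 := hle x y
    have h2 := hle y x
    rw [hsymm y x] at h2
    constructor <;> linarith
  · refine le_antisymm ((ciInf_le (hbdd x) x).trans ?_) (Real.iInf_nonneg (hF0 x))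
    simp [hF, h0, hx]
  · have : Nonempty I := ⟨x⟩
    obtain ⟨y, hy⟩ := exists_lt_of_ciInf_lt hx
    have hyE : y ∈ E := by
      by_contra hyE
      have h1 : Eᶜ.indicator (1 : I → ℝ) y = 1 := Set.indicator_of_mem hyE 1
      have h2 : 0 ≤ d x y / τ := by have := hd x y; positivity
      simp only [hF, h1] at hy
      linarith
    refine ⟨y, hyE, ?_⟩
    have h1 : Eᶜ.indicator (1 : I → ℝ) y = 0 := Set.indicator_of_notMem (by simpa using hyE) 1
    simp only [hF, h1, zero_add] at hy
    rwa [div_lt_one hτ] at hy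

/-- Subordinate functions whose sum is the maximum of a finite family of functions, with
Lipschitz constants that do not depend on the size of the family. -/
theorem exists_lipschitz_partition {I ι : Type*} {d : I → I → ℝ} (S : Finset ι) (φ : ι → I → ℝ)
    {C : ℝ} (hC : ∀ x y, 0 ≤ C * d x y) (h1 : ∀ i x, φ i x ≤ 1) (h0 : ∀ i x, 0 ≤ φ i x)
    (hL : ∀ i x y, |φ i x - φ i y| ≤ C * d x y) :
    ∃ ψ : ι → I → ℝ, (∀ i x, 0 ≤ ψ i x) ∧ (∀ i x, ψ i x ≤ φ i x) ∧
      (∀ i x y, |ψ i x - ψ i y| ≤ 2 * (C * d x y)) ∧ (∀ x, ∑ i ∈ S, ψ i x ≤ 1) ∧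
      (∀ i ∈ S, ∀ x, φ i x ≤ ∑ i ∈ S, ψ i x) ∧
      ∀ x y, |∑ i ∈ S, ψ i x - ∑ i ∈ S, ψ i y| ≤ C * d x y := by
  classical
  induction S using Finset.induction_on with
  | empty =>
    refine ⟨fun _ _ => 0, fun _ _ => le_rfl, h0, fun i x y => ?_, by simp, by simp, ?_⟩
    · simpa using hC x y
    · simpa using hC
  | insert i S hi ih =>
    obtain ⟨ψ, hψ0, hψ1, hψ2, hψ3, hψ4, hψ5⟩ := ih
    set σ : I → ℝ := fun x => ∑ i ∈ S, ψ i x with hσ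
    -- The new function is the part of `φ i` above the current sum `σ`, so the new sum is `max (φ i)
    -- σ`. A maximum keeps the Lipschitz constant `C`, and the difference `φ i - σ` costs at most `2
    -- * C`, however many functions there are.
    set ψ' : ι → I → ℝ := Function.update ψ i fun x => max (φ i x - σ x) 0 with hψ'
    have hsum : ∀ x, ∑ i' ∈ insert i S, ψ' i' x = max (φ i x) (σ x) := by
      intro x
      rw [Finset.sum_insert hi]
      have : ∑ i' ∈ S, ψ' i' x = σ x := by
        refine Finset.sum_congr rfl fun i' hi' => ?_
        rw [hψ', Function.update_of_ne (ne_of_mem_of_not_mem hi' hi)]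
      rw [this, hψ', Function.update_self, ← max_add_add_right]
      simp
    have hσ0 : ∀ x, 0 ≤ σ x := fun x => Finset.sum_nonneg fun i' _ => hψ0 i' x
    refine ⟨ψ', fun i' x => ?_, fun i' x => ?_, fun i' x y => ?_, fun x => ?_,
      fun i' hi' x => ?_, fun x y => ?_⟩
    · rcases eq_or_ne i' i with rfl | hne
      · simp [hψ']
      · simpa [hψ', hne] using hψ0 i' x
    · rcases eq_or_ne i' i with rfl | hne
      · simp [hψ', h0 i' x, hσ0 x]
      · simpa [hψ', hne] using hψ1 i' x
    · rcases eq_or_ne i' i with rfl | hne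
      · simp only [hψ', Function.update_self]
        refine (abs_max_sub_max_le_abs _ _ _).trans ?_
        have e : φ i' x - σ x - (φ i' y - σ y) = (φ i' x - φ i' y) - (σ x - σ y) := by ring
        rw [e, two_mul]
        exact (abs_sub _ _).trans (add_le_add (hL i' x y) (hψ5 x y))
      · simpa [hψ', hne] using hψ2 i' x y
    · rw [hsum]
      exact max_le (h1 i x) (hψ3 x)
    · rw [hsum]
      rcases Finset.mem_insert.1 hi' with rfl | hi'
      · exact le_max_left _ _
      · exact (hψ4 i' hi' x).trans (le_max_right _ _)
    · rw [hsum, hsum]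
      exact (abs_max_sub_max_le_max _ _ _ _).trans (max_le (hL i x y) (hψ5 x y))

/-- `u` is `t` times a Han–Lu–Yang block associated to `Q`, supported in a ball of radius `r k`. -/
structure IsBlockMultiple {I : Type*} [TopologicalSpace I] [MeasurableSpace I] (β : I → I → ℝ)
    (m : Measure I) (γ s p : ℝ) (z : ℕ → Set I → I) (r : ℕ → ℝ) (k : ℕ) (Q : Set I) (t : ℝ≥0)
    (u : I → ℂ) : Prop where
  tsupport_subset : tsupport u ⊆ qBall β (z k Q) (r k)
  bound : ∀ x, ‖u x‖ ≤ t * m.real Q ^ (s - 1 / p)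
  holder : ∀ x y, ‖u x - u y‖ ≤ t * (m.real Q ^ (s - 1 / p - γ) * β x y ^ γ)

theorem isAtomGauge_isBlockMultiple {I : Type*} [TopologicalSpace I] [MeasurableSpace I]
    (β : I → I → ℝ) (m : Measure I) (γ s p : ℝ) (z : ℕ → Set I → I) (r : ℕ → ℝ) :
    IsAtomGauge (IsBlockMultiple β m γ s p z r) where
  zero := fun k Q => ⟨by simp [tsupport], by simp, by simp⟩
  add := by
    intro k Q t t' u u' h h'
    refine ⟨(tsupport_add u u').trans (Set.union_subset h.tsupport_subset h'.tsupport_subset),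
      fun x => ?_, fun x y => ?_⟩
    · push_cast
      rw [add_mul]
      exact (norm_add_le _ _).trans (add_le_add (h.bound x) (h'.bound x))
    · push_cast
      rw [add_mul, Pi.add_apply, Pi.add_apply, add_sub_add_comm]
      exact (norm_add_le _ _).trans (add_le_add (h.holder x y) (h'.holder x y))
  smul := by
    intro k Q t u w h
    refine ⟨(closure_mono (Function.support_const_smul_subset w u)).trans h.tsupport_subset,
      fun x => ?_, fun x y => ?_⟩
    · rw [Pi.smul_apply, norm_smul, NNReal.coe_mul, coe_nnnorm, mul_assoc]
      gcongr
      exact h.bound x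
    · rw [Pi.smul_apply, Pi.smul_apply, ← smul_sub, norm_smul, NNReal.coe_mul, coe_nnnorm,
        mul_assoc]
      gcongr
      exact h.holder x y

theorem IsBlockMultiple.exists_block {I : Type*} [TopologicalSpace I] [MeasurableSpace I]
    {β : I → I → ℝ} {m : Measure I} {γ s p : ℝ} {z : ℕ → Set I → I} {r : ℕ → ℝ} {k : ℕ}
    {Q : Set I} {t : ℝ≥0} {u : I → ℂ} (hβ : ∀ x y, 0 ≤ β x y)
    (h : IsBlockMultiple β m γ s p z r k Q t u) :
    ∃ a, IsHLYBlock β m γ s p Q (z k Q) (r k) a ∧ ∀ x, u x = ((t : ℝ) : ℂ) * a x := by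
  by_cases ht : t = 0
  · refine ⟨0, ⟨by simp [tsupport], fun x => ?_, fun x y => ?_⟩, fun x => ?_⟩
    · simp only [Pi.zero_apply, norm_zero]
      positivity
    · have := hβ x y
      simp only [Pi.zero_apply, sub_zero, norm_zero]
      positivity
    · have := h.bound x
      simpa [ht] using this
  · have ht0 : 0 < (t : ℝ) := by positivity
    have htC : ((t : ℝ) : ℂ) ≠ 0 := Complex.ofReal_ne_zero.2 ht0.ne'
    refine ⟨fun x => ((t : ℝ) : ℂ)⁻¹ * u x,
      ⟨(closure_mono (Function.support_const_smul_subset ((t : ℝ) : ℂ)⁻¹ u)).trans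
        h.tsupport_subset, fun x => ?_, fun x y => ?_⟩,
      fun x => ?_⟩
    · rw [norm_mul, norm_inv, Complex.norm_real, Real.norm_of_nonneg ht0.le,
        inv_mul_le_iff₀ ht0]
      exact h.bound x
    · rw [← mul_sub, norm_mul, norm_inv, Complex.norm_real, Real.norm_of_nonneg ht0.le,
        inv_mul_le_iff₀ ht0]
      exact h.holder x y
    · rw [mul_inv_cancel_left₀ htC]

namespace IsRegularGrid

variable {I : Type*} [TopologicalSpace I] [MeasurableSpace I] {β d : I → I → ℝ}
    {m : Measure I} {P : ℕ → Finset (Set I)} {z : ℕ → Set I → I}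
    {A γ L κ D a b Λ B η C₂ : ℝ}

theorem dist_nonneg (h : IsRegularGrid β d m P z A γ L κ D a b Λ B η C₂) (x y : I) :
    0 ≤ d x y := by
  have := h.dist_triangle x y x
  rw [h.dist_self, h.dist_symm y x] at this
  linarith

theorem lt_of_dist_lt (h : IsRegularGrid β d m P z A γ L κ D a b Λ B η C₂) {x y : I} {c : ℝ}
    (hc : 0 ≤ c) (hxy : L * d x y < c ^ γ) : β x y < c :=
  (Real.rpow_lt_rpow_iff (h.nonneg x y) hc h.γ_pos).1 ((h.le_dist x y).trans_lt hxy)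

/-- A partition of unity at each level `j ≥ 1`, at scale `(κ ^ γ) ^ j` for the metric `d`. -/
theorem exists_partition (h : IsRegularGrid β d m P z A γ L κ D a b Λ B η C₂) :
    ∃ (t : ℝ) (ψ : ℕ → Set I → I → ℝ), 0 < t ∧ (∀ j R x, 0 ≤ ψ j R x) ∧ (∀ j R x, ψ j R x ≤ 1) ∧
      (∀ j R x y, |ψ j R x - ψ j R y| ≤ 2 / (t * (κ ^ γ) ^ j) * d x y) ∧
      (∀ᵐ x ∂m, ∀ j, ∑ R ∈ P j, ψ j R x = 1) ∧
      (∀ j R x, ψ j R x ≠ 0 → ∃ y ∈ R, d x y < t * (κ ^ γ) ^ j) ∧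
      ∀ j, 1 ≤ j → ∀ R ∈ P j, closure {x | ψ j R x ≠ 0} ⊆ qBall β (z j R) (3 * A * C₂ * κ ^ j) := by
  have hκ := h.κ_pos
  have hγ := h.γ_pos
  have hL := h.L_pos
  have hC₂ := h.C₂_pos
  have hA : 0 < A := zero_lt_one.trans_le h.one_le_A
  -- Two steps of `d`-length `t * (κ ^ γ) ^ j` amount to at most `C₂ * κ ^ j` for `β`: one leads
  -- from the support to the cell, the other is the slack for taking the closure.
  set t : ℝ := C₂ ^ γ / (2 * L) with ht
  have ht0 : 0 < t := by positivity
  have hτ : ∀ j : ℕ, 0 < t * (κ ^ γ) ^ j := fun j => by positivity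
  have hcut := fun (j : ℕ) (R : Set I) =>
    exists_lipschitz_cutoff h.dist_self h.dist_symm h.dist_triangle R (hτ j)
  choose φ hφ0 hφ1 hφL hφz hφn using hcut
  have hpart := fun j : ℕ => exists_lipschitz_partition (d := d) (P j) (fun R x => 1 - φ j R x)
    (C := 1 / (t * (κ ^ γ) ^ j))
    (fun x y => mul_nonneg (by have := hτ j; positivity) (h.dist_nonneg x y))
    (fun R x => by linarith [hφ0 j R x]) (fun R x => by linarith [hφ1 j R x])
    (fun R x y => by
      rw [sub_sub_sub_cancel_left, abs_sub_comm]
      exact hφL j R x y)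
  choose ψ hψ0 hψ1 hψL hψs hψm _ using hpart
  have hnear : ∀ j R x, ψ j R x ≠ 0 → ∃ y ∈ R, d x y < t * (κ ^ γ) ^ j := by
    intro j R x hx
    refine hφn j R x ?_
    have := lt_of_le_of_ne (hψ0 j R x) hx.symm
    linarith [hψ1 j R x]
  refine ⟨t, ψ, ht0, hψ0, fun j R x => ?_, fun j R x y => ?_, ?_, hnear, fun j hj R hR x hx => ?_⟩
  · linarith [hψ1 j R x, hφ0 j R x]
  · refine (hψL j R x y).trans (le_of_eq ?_)
    ring
  · filter_upwards [h.ae_existsUnique] with x hx j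
    obtain ⟨R, hR, hxR⟩ := (hx j).exists
    refine le_antisymm (hψs j x) ?_
    have := hψm j R hR x
    rwa [hφz j R x hxR, sub_zero] at this
  · set ε : ℝ := (t * (κ ^ γ) ^ j / L) ^ (1 / γ) with hε
    have hε0 : 0 < ε := by have := hτ j; positivity
    obtain ⟨w, hw, hwR⟩ := mem_closure_iff_nhds.1 hx _ (h.lt_mem_nhds x ε hε0)
    obtain ⟨y, hy, hwy⟩ := hnear j R w hwR
    have h1 : d x w < t * (κ ^ γ) ^ j := by
      calc _ ≤ L * β x w ^ γ := h.dist_le x w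
        _ < L * ε ^ γ := by
            have : β x w < ε := hw
            have := h.nonneg x w
            gcongr
        _ = _ := by
            rw [hε, ← Real.rpow_mul (by have := hτ j; positivity), one_div_mul_cancel hγ.ne',
              Real.rpow_one]
            field_simp
    have h2 : β x y < C₂ * κ ^ j := by
      refine h.lt_of_dist_lt (by positivity) ?_
      calc L * d x y ≤ L * (d x w + d w y) := by
            gcongr
            exact h.dist_triangle x w y
        _ < L * (t * (κ ^ γ) ^ j + t * (κ ^ γ) ^ j) := by gcongr
        _ = C₂ ^ γ * (κ ^ γ) ^ j := by
            rw [ht]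
            field_simp
            ring
        _ = _ := by rw [Real.mul_rpow hC₂.le (by positivity), Real.rpow_pow_comm hκ.le]
    -- Only for `j ≥ 1` is the diameter bounded by `C₂ * κ ^ j`; with the previous bound this gives
    -- `2 * A * C₂ * κ ^ j`, below the allowed radius.
    have h3 := h.diam_le_of_one_le j hj R hR _ (h.center_mem j R hR) y hy
    calc β (z j R) x ≤ A * (β (z j R) y + β y x) := h.quasi_triangle _ _ _
      _ ≤ A * (C₂ * κ ^ j + C₂ * κ ^ j) := by
          rw [h.symm y x]
          gcongr
      _ < 3 * A * C₂ * κ ^ j := by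
          have : 0 < A * C₂ * κ ^ j := by positivity
          nlinarith

end IsRegularGrid

/-! ### From Souza atoms to Han–Lu–Yang blocks -/

namespace IsRegularGrid

variable {I : Type*} [TopologicalSpace I] [MeasurableSpace I] {β d : I → I → ℝ}
    {m : Measure I} {P : ℕ → Finset (Set I)} {z : ℕ → Set I → I}
    {A γ L κ D a b Λ B η C₂ : ℝ}

/-- Approximations `H k Q n` of the indicator of a cell `Q` of level `k` from inside, at scale
`(κ ^ γ) ^ n`, vanishing for `n ≤ k`. -/
theorem exists_inner_cutoff (h : IsRegularGrid β d m P z A γ L κ D a b Λ B η C₂) {t : ℝ}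
    (ht : 0 < t) :
    ∃ H : ℕ → Set I → ℕ → I → ℝ, (∀ k Q n x, 0 ≤ H k Q n x) ∧ (∀ k Q n x, H k Q n x ≤ 1) ∧
      (∀ k Q n x y, |H k Q n x - H k Q n y| ≤ 1 / (t * (κ ^ γ) ^ n) * d x y) ∧
      (∀ k Q n x y, y ∉ Q → d x y ≤ t * (κ ^ γ) ^ n → H k Q n x = 0) ∧
      (∀ k Q n, n ≤ k → H k Q n = 0) ∧
      ∀ k Q n x, k < n → H k Q n x < 1 → ∃ y, y ∉ Q ∧ d x y < 2 * (t * (κ ^ γ) ^ n) := by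
  have hκ := h.κ_pos
  have hτ : ∀ n : ℕ, 0 < t * (κ ^ γ) ^ n := fun n => by positivity
  -- The functions vanish on a whole neighbourhood of the complement of `Q`. This margin will force
  -- the cells of level `n` near their support to lie inside `Q`.
  have hcut := fun (Q : Set I) (n : ℕ) =>
    exists_lipschitz_cutoff h.dist_self h.dist_symm h.dist_triangle
      {x | ∃ y, y ∉ Q ∧ d x y ≤ t * (κ ^ γ) ^ n} (hτ n)
  choose φ hφ0 hφ1 hφL hφz hφn using hcut
  refine ⟨fun k Q n x => if n ≤ k then 0 else φ Q n x, fun k Q n x => ?_, fun k Q n x => ?_,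
    fun k Q n x y => ?_, fun k Q n x y hy hxy => ?_, fun k Q n hn => ?_, fun k Q n x hn hx => ?_⟩
  · dsimp only
    split_ifs
    exacts [le_rfl, hφ0 Q n x]
  · dsimp only
    split_ifs
    exacts [zero_le_one, hφ1 Q n x]
  · dsimp only
    split_ifs
    · rw [sub_zero, abs_zero]
      exact mul_nonneg (by have := hτ n; positivity) (h.dist_nonneg x y)
    · exact hφL Q n x y
  · dsimp only
    split_ifs
    exacts [rfl, hφz Q n x ⟨y, hy, hxy⟩]
  · ext x
    simp [hn]
  · dsimp only at hx
    rw [if_neg (not_le.2 hn)] at hx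
    obtain ⟨w, ⟨y, hy, hwy⟩, hxw⟩ := hφn Q n x hx
    refine ⟨y, hy, (h.dist_triangle x w y).trans_lt ?_⟩
    linarith

/-- The measure of the layers along the boundaries of the cells; the layers are the whole cell
on the first two levels. -/
theorem exists_layer_bound [IsFiniteMeasure m]
    (h : IsRegularGrid β d m P z A γ L κ D a b Λ B η C₂) {t : ℝ} (ht : 0 < t) :
    ∃ M : ℝ, 0 < M ∧ ∀ k, ∀ Q ∈ P k, ∀ j, k ≤ j →
      m.real {x | x ∈ Q ∧ (j ≤ k + 1 ∨ ∃ y, y ∉ Q ∧ β x y ≤ t * κ ^ j)} ≤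
        M * ((κ ^ η) ^ (j - k) * κ ^ k) := by
  have hκ := h.κ_pos
  have hκ1 := h.κ_lt_one.le
  have hb := h.b_pos
  have hB := h.B_pos
  have hη := h.η_nonneg
  -- The term `b * κ ^ (-η)` pays for `j = k` and `j = k + 1`, where the layer is all of `Q` and `(κ
  -- ^ η) ^ (j - k) ≥ κ ^ η`.
  refine ⟨B * t ^ η * b + b * κ ^ (-η), by positivity, fun k Q hQ j hkj => ?_⟩
  have hQb := h.measureReal_le k Q hQ
  obtain ⟨i, rfl⟩ := Nat.exists_eq_add_of_le hkj
  rw [Nat.add_sub_cancel_left]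
  by_cases hi : i ≤ 1
  · have h1 : 1 ≤ κ ^ (-η) * (κ ^ η) ^ i := by
      have h2 : κ ^ (-η) * κ ^ η = 1 := by rw [← Real.rpow_add hκ]; simp
      rw [← h2]
      gcongr
      have h3 : κ ^ η ≤ 1 := Real.rpow_le_one hκ.le hκ1 hη
      simpa using pow_le_pow_of_le_one (by positivity) h3 hi
    calc _ ≤ m.real Q := measureReal_mono fun x hx => hx.1
      _ ≤ b * κ ^ k := hQb
      _ ≤ b * κ ^ k * (κ ^ (-η) * (κ ^ η) ^ i) := le_mul_of_one_le_right (by positivity) h1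
      _ = b * κ ^ (-η) * ((κ ^ η) ^ i * κ ^ k) := by ring
      _ ≤ _ := by
          gcongr
          have : 0 < B * t ^ η * b := by positivity
          linarith
  · have h1 := h.layer_le k Q hQ (t * κ ^ i) (by positivity)
    calc _ ≤ m.real {x | x ∈ Q ∧ ∃ y, y ∉ Q ∧ β x y ≤ t * κ ^ i * κ ^ k} := by
          refine measureReal_mono ?_
          rintro x ⟨hx, hx' | ⟨y, hy, hxy⟩⟩
          · omega
          · refine ⟨hx, y, hy, hxy.trans (le_of_eq ?_)⟩
            rw [pow_add]
            ring
      _ ≤ B * (t * κ ^ i) ^ η * m.real Q := h1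
      _ ≤ B * (t * κ ^ i) ^ η * (b * κ ^ k) := by gcongr
      _ = B * t ^ η * b * ((κ ^ η) ^ i * κ ^ k) := by
          rw [Real.mul_rpow ht.le (by positivity), Real.rpow_pow_comm hκ.le]
          ring
      _ ≤ _ := by
          gcongr
          have : 0 < b * κ ^ (-η) := by positivity
          linarith

/-- The margin `t'` is the reach `t` of the partition of unity plus the bound `L * D ^ γ` for the
`d`-diameter of a cell, both in units of `(κ ^ γ) ^ j`. If `R` had a point outside `Q`, then `x`
would be in the zone where the cutoff vanishes. -/
theorem subset_cell_of_cutoff_ne_zero (h : IsRegularGrid β d m P z A γ L κ D a b Λ B η C₂)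
    {t t' : ℝ} (ht : t + L * D ^ γ = t') {H : ℕ → Set I → ℕ → I → ℝ}
    (hH : ∀ k Q n x y, y ∉ Q → d x y ≤ t' * (κ ^ γ) ^ n → H k Q n x = 0)
    {j : ℕ} {R : Set I} (hR : R ∈ P j) {x r : I} (hr : r ∈ R) (hxr : d x r < t * (κ ^ γ) ^ j)
    (ht' : 0 < t') :
    (∀ y ∈ R, d x y ≤ t' * (κ ^ γ) ^ j) ∧
      ∀ k Q n, n ≤ j → H k Q n x ≠ 0 → R ⊆ Q := by
  have hκ := h.κ_pos
  have hL := h.L_pos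
  have hD := h.D_pos
  have hγ := h.γ_pos
  have key : ∀ y ∈ R, d x y ≤ t' * (κ ^ γ) ^ j := by
    intro y hy
    calc d x y ≤ d x r + d r y := h.dist_triangle x r y
      _ ≤ t * (κ ^ γ) ^ j + L * (D * κ ^ j) ^ γ := by
          have := h.nonneg r y
          refine add_le_add hxr.le ((h.dist_le r y).trans ?_)
          gcongr
          exact h.diam_le j R hR r hr y hy
      _ = _ := by
          rw [Real.mul_rpow hD.le (by positivity), ← Real.rpow_pow_comm hκ.le, ← ht]
          ring
  refine ⟨key, fun k Q n hn hne y hy => ?_⟩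
  by_contra hyQ
  refine hne (hH k Q n x y hyQ ((key y hy).trans ?_))
  have h1 : κ ^ γ ≤ 1 := Real.rpow_le_one hκ.le h.κ_lt_one.le hγ.le
  exact mul_le_mul_of_nonneg_left (pow_le_pow_of_le_one (by positivity) h1 hn) ht'.le

/-- The pieces are `(H k Q j - H k Q (j - 1)) * ψ j R`. Since `μ` compares only the heights of
atoms, the gain comes from `ν`: the cells `R` in use fill no more than a thin layer of `Q`. -/
theorem exists_transfer_block [BorelSpace I] [IsFiniteMeasure m]
    (h : IsRegularGrid β d m P z A γ L κ D a b Λ B η C₂) {s p : ℝ} (hp : 1 ≤ p) (hη : s * p < η)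
    {μ ν θ : ℝ≥0} (hμ : (μ : ℝ) = κ ^ (1 / p - s)) (hν : (ν : ℝ) = κ ^ (η - 1))
    (hθ : (θ : ℝ) = κ ^ s) :
    ∃ Γ : ℝ≥0, 1 ≤ Γ ∧ ∃ S u, IsAtomicTransfer m P p (fun _ Q => souzaAtom m s p Q) S u
      (IsBlockMultiple β m γ s p z fun k => 3 * A * C₂ * κ ^ k) Γ μ ν θ := by
  have hκ := h.κ_pos
  have hκ1 := h.κ_lt_one.le
  have ha := h.a_pos
  have hb := h.b_pos
  have hD := h.D_pos
  have hL := h.L_pos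
  have hγ := h.γ_pos
  have hp0 : 0 < p := by linarith
  obtain ⟨M, hM1, hM⟩ := h.exists_rpow_bounds (s - 1 / p - γ)
  obtain ⟨M', hM'1, hM'⟩ := h.exists_rpow_bounds (s - 1 / p)
  obtain ⟨t, ψ, ht, hψ0, hψ1, hψL, hψs, hψn, hψt⟩ := h.exists_partition
  obtain ⟨t', ht'⟩ : ∃ t', t + L * D ^ γ = t' := ⟨_, rfl⟩
  have ht'0 : 0 < t' := by rw [← ht']; positivity
  obtain ⟨H, hH0, hH1, hHL, hHz, hHk, hHn⟩ := h.exists_inner_cutoff ht'0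
  -- The factor `4` exceeds `2 + 1`, the reach `2` of the cutoff zone plus the distance `1` from `x`
  -- to points of `R`, in units of `t' * (κ ^ γ) ^ n`; the division by `κ` passes from level `n` to
  -- `n + 1`.
  set w : ℝ := (4 * L * t') ^ (1 / γ) / κ with hw
  have hw0 : 0 < w := by positivity
  obtain ⟨X, hX, hlayer⟩ := h.exists_layer_bound hw0
  have hτ : ∀ n : ℕ, 0 < (κ ^ γ) ^ n := fun n => by positivity
  -- points near the boundary layer at level `n` belong to the layer of level `n + 1`
  have hnear : ∀ n x y, d x y < 4 * (t' * (κ ^ γ) ^ n) → β x y ≤ w * κ ^ (n + 1) := by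
    intro n x y hxy
    refine (h.lt_of_dist_lt (by positivity) ?_).le
    calc L * d x y < L * (4 * (t' * (κ ^ γ) ^ n)) := by gcongr
      _ = (w * κ ^ (n + 1)) ^ γ := by
          have e : w * κ ^ (n + 1) = (4 * L * t') ^ (1 / γ) * κ ^ n := by
            rw [hw, pow_succ]
            field_simp
          rw [e, Real.mul_rpow (by positivity) (by positivity), ← Real.rpow_mul (by positivity),
            one_div_mul_cancel hγ.ne', Real.rpow_one, Real.rpow_pow_comm hκ.le]
          ring
  have hcell : ∀ j, ∀ R ∈ P j, ∀ x, ψ j R x ≠ 0 →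
      (∀ y ∈ R, d x y ≤ t' * (κ ^ γ) ^ j) ∧ ∀ k Q n, n ≤ j → H k Q n x ≠ 0 → R ⊆ Q := by
    intro j R hR x hx
    obtain ⟨r, hr, hxr⟩ := hψn j R x hx
    exact h.subset_cell_of_cutoff_ne_zero ht' hHz hR hr hxr ht'0
  -- With `H` at index `N - 1`, the increment from `j` to `j + 1` is that of `H` from `j - 1` to
  -- `j`. As `H` vanishes up to level `k`, the first nonzero piece has level `k + 1 ≥ 1`, so the
  -- supports are never needed on level `0`, where `C₂` does not control them.
  set S : ℕ → Set I → ℕ → I → ℂ := fun k Q N x =>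
    ((m.real Q ^ (s - 1 / p) * H k Q (N - 1) x : ℝ) : ℂ) with hS
  set v : ℕ → Set I → ℕ → Set I → I → ℝ := fun k Q j R x =>
    (H k Q j x - H k Q (j - 1) x) * ψ j R x with hv
  set u : ℕ → Set I → ℕ → Set I → I → ℂ := fun k Q j R x =>
    ((m.real Q ^ (s - 1 / p) * v k Q j R x : ℝ) : ℂ) with hu
  have hv_zero : ∀ k Q j R, j ≤ k → v k Q j R = 0 := by
    intro k Q j R hjk
    ext x
    simp [hv, hHk k Q j hjk, hHk k Q (j - 1) (by omega)]
  have hv_of_u : ∀ k Q j R, u k Q j R ≠ 0 → ∃ x, v k Q j R x ≠ 0 := by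
    intro k Q j R hne
    by_contra hcon
    push Not at hcon
    refine hne ?_
    ext x
    simp [hu, hcon x]
  have hv_sub : ∀ k Q j, ∀ R ∈ P j, ∀ x, v k Q j R x ≠ 0 → R ⊆ Q := by
    intro k Q j R hR x hne
    have h1 : ψ j R x ≠ 0 := right_ne_zero_of_mul hne
    have h2 : H k Q j x - H k Q (j - 1) x ≠ 0 := left_ne_zero_of_mul hne
    by_cases h3 : H k Q j x = 0
    · refine (hcell j R hR x h1).2 k Q (j - 1) (by omega) fun h4 => ?_
      rw [h3, h4, sub_zero] at h2
      exact h2 rfl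
    · exact (hcell j R hR x h1).2 k Q j le_rfl h3
  have hv_layer : ∀ k Q j, k ≤ j → ∀ R ∈ P j, ∀ x, v k Q j R x ≠ 0 →
      R ⊆ {x | x ∈ Q ∧ (j ≤ k + 1 ∨ ∃ y, y ∉ Q ∧ β x y ≤ w * κ ^ j)} := by
    intro k Q j hkj R hR x hne r hr
    refine ⟨hv_sub k Q j R hR x hne hr, ?_⟩
    by_cases hj : j ≤ k + 1
    · exact Or.inl hj
    · right
      obtain ⟨n, rfl⟩ : ∃ n, j = n + 1 := ⟨j - 1, by omega⟩
      have h1 : ψ (n + 1) R x ≠ 0 := right_ne_zero_of_mul hne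
      have h2 : H k Q (n + 1) x - H k Q n x ≠ 0 := left_ne_zero_of_mul hne
      have h5 : t' * (κ ^ γ) ^ (n + 1) ≤ t' * (κ ^ γ) ^ n := by
        refine mul_le_mul_of_nonneg_left (pow_le_pow_of_le_one (by positivity)
          (Real.rpow_le_one hκ.le hκ1 hγ.le) (by omega)) ht'0.le
      -- If both cutoffs were `1` at `x` the increment would vanish; so one is less than `1`, and
      -- `x` is close to the complement of `Q`.
      have h3 : ∃ y, y ∉ Q ∧ d x y < 2 * (t' * (κ ^ γ) ^ n) := by
        rcases lt_or_eq_of_le (hH1 k Q n x) with hlt | heq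
        · exact hHn k Q n x (by omega) hlt
        · rcases lt_or_eq_of_le (hH1 k Q (n + 1) x) with hlt | heq'
          · obtain ⟨y, hy, hxy⟩ := hHn k Q (n + 1) x (by omega) hlt
            exact ⟨y, hy, by linarith⟩
          · rw [heq, heq', sub_self] at h2
            exact absurd rfl h2
      obtain ⟨y, hy, hxy⟩ := h3
      refine ⟨y, hy, hnear n r y ?_⟩
      have h4 := (hcell (n + 1) R hR x h1).1 r hr
      have h6 := h.dist_triangle r x y
      rw [h.dist_symm r x] at h6
      have := hτ n
      have : 0 < t' * (κ ^ γ) ^ n := by positivity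
      linarith
  have hS_supp : ∀ k, ∀ Q ∈ P k, ∀ N, k ≤ N → ∀ x,
      ‖souzaAtom m s p Q x - S k Q N x‖ ≤ m.real Q ^ (s - 1 / p) ∧
      (souzaAtom m s p Q x - S k Q N x ≠ 0 →
        x ∈ {x | x ∈ Q ∧ (N ≤ k + 1 ∨ ∃ y, y ∉ Q ∧ β x y ≤ w * κ ^ N)}) := by
    intro k Q hQ N hkN x
    by_cases hxQ : x ∈ Q
    · have e : souzaAtom m s p Q x - S k Q N x =
          ((m.real Q ^ (s - 1 / p) * (1 - H k Q (N - 1) x) : ℝ) : ℂ) := by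
        simp only [souzaAtom, Set.indicator_of_mem hxQ, hS]
        push_cast
        ring
      have h0 := hH0 k Q (N - 1) x
      have h1 := hH1 k Q (N - 1) x
      rw [e]
      constructor
      · rw [Complex.norm_real, norm_mul, Real.norm_of_nonneg (by positivity),
          Real.norm_of_nonneg (by linarith)]
        exact mul_le_of_le_one_right (by positivity) (by linarith)
      · intro hne
        refine ⟨hxQ, ?_⟩
        by_cases hN : N ≤ k + 1
        · exact Or.inl hN
        · right
          obtain ⟨n, rfl⟩ : ∃ n, N = n + 1 := ⟨N - 1, by omega⟩
          rw [Nat.add_sub_cancel] at hne h1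
          have hlt : H k Q n x < 1 := by
            refine lt_of_le_of_ne h1 fun heq => hne ?_
            simp [heq]
          obtain ⟨y, hy, hxy⟩ := hHn k Q n x (by omega) hlt
          refine ⟨y, hy, hnear n x y ?_⟩
          have := hτ n
          have : 0 < t' * (κ ^ γ) ^ n := by positivity
          linarith
    · have hz : H k Q (N - 1) x = 0 :=
        hHz k Q (N - 1) x x hxQ (by rw [h.dist_self]; have := hτ (N - 1); positivity)
      have e : souzaAtom m s p Q x - S k Q N x = 0 := by
        simp [souzaAtom, Set.indicator_of_notMem hxQ, hS, hz]
      rw [e]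
      exact ⟨by rw [norm_zero]; positivity, fun hne => absurd rfl hne⟩
  set Γ₁ : ℝ := X / a with hΓ₁
  set Γ₂ : ℝ := M' * M' with hΓ₂
  set Γ₃ : ℝ := M' * M * ((2 / t' + 2 / t) * L) with hΓ₃
  set Γ₄ : ℝ := M' * X ^ (1 / p) with hΓ₄
  have hΓ₁0 : 0 < Γ₁ := by positivity
  have hΓ₂0 : 0 < Γ₂ := by positivity
  have hΓ₃0 : 0 < Γ₃ := by positivity
  have hΓ₄0 : 0 < Γ₄ := by positivity
  obtain ⟨Γ, hΓ⟩ : ∃ Γ : ℝ≥0, (Γ : ℝ) = 1 + Γ₁ + Γ₂ + Γ₃ + Γ₄ := ⟨⟨_, by positivity⟩, rfl⟩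
  have hΓ1 : 1 ≤ Γ := by
    rw [← NNReal.coe_le_coe, hΓ, NNReal.coe_one]
    linarith
  refine ⟨Γ, hΓ1, S, u,
    { aestronglyMeasurable := fun k Q hQ => ?_
      aestronglyMeasurable_approx := fun k Q hQ N => ?_
      eq_zero := fun k Q hQ N hN => ?_
      sub_eq := fun k Q hQ j hkj => ?_
      gauge := fun k Q hQ j hkj R hR => ?_
      card_target := fun k Q hQ j hkj => ?_
      card_source := fun j R hR k hkj => ?_
      approx := fun k Q hQ N hkN => ?_
      overlap := fun k N hkN => ?_ }⟩
  · exact (measurable_const.indicator (h.measurableSet k Q hQ)).aestronglyMeasurable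
  · have : Continuous (H k Q (N - 1)) := by
      refine h.continuous_of_holder (C := 1 / (t' * (κ ^ γ) ^ (N - 1)) * L) fun x y => ?_
      rw [Real.norm_eq_abs, mul_assoc]
      refine (hHL k Q (N - 1) x y).trans ?_
      have := hτ (N - 1)
      gcongr
      exact h.dist_le x y
    exact (Complex.continuous_ofReal.comp (continuous_const.mul this)).aestronglyMeasurable
  · ext x
    simp [hS, hHk k Q (N - 1) (by omega)]
  · filter_upwards [hψs] with x hx
    simp only [hS, hu, hv, Nat.add_sub_cancel]
    rw [← Complex.ofReal_sub, ← Complex.ofReal_sum, ← Finset.mul_sum, ← Finset.mul_sum, hx j]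
    congr 1
    ring
  · rcases le_or_gt j k with hjk | hjk
    · have hu0 : u k Q j R = 0 := by
        ext x
        simp [hu, hv_zero k Q j R hjk]
      rw [hu0]
      refine ⟨by simp [tsupport], fun x => ?_, fun x y => ?_⟩
      · rw [Pi.zero_apply, norm_zero]
        positivity
      · have := h.nonneg x y
        rw [Pi.zero_apply, Pi.zero_apply, sub_zero, norm_zero]
        positivity
    · have hpw : (κ ^ (s - 1 / p)) ^ k = (κ ^ (1 / p - s)) ^ (j - k) * (κ ^ (s - 1 / p)) ^ j := by
        obtain ⟨i, rfl⟩ := Nat.exists_eq_add_of_le hkj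
        rw [Nat.add_sub_cancel_left, pow_add, mul_left_comm, ← mul_pow, ← Real.rpow_add hκ,
          sub_add_sub_cancel]
        simp
      have hv1 : ∀ x, |v k Q j R x| ≤ 1 := by
        intro x
        simp only [hv]
        rw [abs_mul, abs_of_nonneg (hψ0 j R x)]
        refine mul_le_one₀ (abs_le.2 ?_) (hψ0 j R x) (hψ1 j R x)
        constructor <;>
          linarith [hH0 k Q j x, hH1 k Q j x, hH0 k Q (j - 1) x, hH1 k Q (j - 1) x]
      have hvL : ∀ x y, |v k Q j R x - v k Q j R y| ≤
          (2 / t' + 2 / t) * L * β x y ^ γ * ((κ ^ γ) ^ j)⁻¹ := by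
        intro x y
        have hd := h.dist_nonneg x y
        have hτj := hτ j
        have hτj1 := hτ (j - 1)
        have e : v k Q j R x - v k Q j R y =
            ((H k Q j x - H k Q j y) - (H k Q (j - 1) x - H k Q (j - 1) y)) * ψ j R x +
              (H k Q j y - H k Q (j - 1) y) * (ψ j R x - ψ j R y) := by
          simp only [hv]
          ring
        have h1 : |(H k Q j x - H k Q j y) - (H k Q (j - 1) x - H k Q (j - 1) y)| ≤
            2 / t' * ((κ ^ γ) ^ j)⁻¹ * d x y := by
          have h2 : 1 / (t' * (κ ^ γ) ^ (j - 1)) * d x y ≤ 1 / (t' * (κ ^ γ) ^ j) * d x y := by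
            refine mul_le_mul_of_nonneg_right (one_div_le_one_div_of_le (by positivity) ?_) hd
            exact mul_le_mul_of_nonneg_left (pow_le_pow_of_le_one (by positivity)
              (Real.rpow_le_one hκ.le hκ1 hγ.le) (by omega)) ht'0.le
          refine (abs_sub _ _).trans ?_
          calc _ ≤ 1 / (t' * (κ ^ γ) ^ j) * d x y + 1 / (t' * (κ ^ γ) ^ j) * d x y :=
                add_le_add (hHL k Q j x y) ((hHL k Q (j - 1) x y).trans h2)
            _ = _ := by
                field_simp
                ring
        have h3 : |H k Q j y - H k Q (j - 1) y| ≤ 1 := by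
          refine abs_le.2 ?_
          constructor <;>
            linarith [hH0 k Q j y, hH1 k Q j y, hH0 k Q (j - 1) y, hH1 k Q (j - 1) y]
        rw [e]
        refine (abs_add_le _ _).trans ?_
        rw [abs_mul, abs_mul, abs_of_nonneg (hψ0 j R x)]
        calc _ ≤ 2 / t' * ((κ ^ γ) ^ j)⁻¹ * d x y * 1 + 1 * (2 / (t * (κ ^ γ) ^ j) * d x y) := by
              refine add_le_add (mul_le_mul h1 (hψ1 j R x) (hψ0 j R x) (by positivity))
                (mul_le_mul h3 (hψL j R x y) (abs_nonneg _) zero_le_one)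
          _ = (2 / t' + 2 / t) * d x y * ((κ ^ γ) ^ j)⁻¹ := by
              field_simp
          _ ≤ (2 / t' + 2 / t) * (L * β x y ^ γ) * ((κ ^ γ) ^ j)⁻¹ := by
              gcongr
              exact h.dist_le x y
          _ = _ := by ring
      refine ⟨(closure_mono fun x hx => ?_).trans (hψt j (by omega) R hR), fun x => ?_,
        fun x y => ?_⟩
      · intro h0
        refine hx ?_
        simp [hu, hv, h0]
      · simp only [hu]
        rw [Complex.norm_real, norm_mul, Real.norm_of_nonneg (by positivity), Real.norm_eq_abs,
          NNReal.coe_mul, NNReal.coe_pow, hΓ, hμ]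
        calc _ ≤ m.real Q ^ (s - 1 / p) := mul_le_of_le_one_right (by positivity) (hv1 x)
          _ ≤ M' * ((κ ^ (1 / p - s)) ^ (j - k) * (κ ^ (s - 1 / p)) ^ j) := by
              rw [← hpw]
              exact (hM' k Q hQ).1
          _ ≤ M' * ((κ ^ (1 / p - s)) ^ (j - k) * (M' * m.real R ^ (s - 1 / p))) := by
              gcongr
              exact (hM' j R hR).2
          _ = Γ₂ * (κ ^ (1 / p - s)) ^ (j - k) * m.real R ^ (s - 1 / p) := by
              rw [hΓ₂]
              ring
          _ ≤ _ := by
              gcongr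
              linarith
      · have hβ := h.nonneg x y
        have hpw' : (κ ^ (s - 1 / p)) ^ j * ((κ ^ γ) ^ j)⁻¹ = (κ ^ (s - 1 / p - γ)) ^ j := by
          rw [Real.rpow_sub hκ _ γ, div_pow, ← div_eq_mul_inv]
        simp only [hu]
        rw [← Complex.ofReal_sub, ← mul_sub, Complex.norm_real, norm_mul,
          Real.norm_of_nonneg (by positivity), Real.norm_eq_abs, NNReal.coe_mul, NNReal.coe_pow,
          hΓ, hμ]
        calc _ ≤ M' * ((κ ^ (1 / p - s)) ^ (j - k) * (κ ^ (s - 1 / p)) ^ j) *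
              ((2 / t' + 2 / t) * L * β x y ^ γ * ((κ ^ γ) ^ j)⁻¹) := by
              rw [← hpw]
              exact mul_le_mul (hM' k Q hQ).1 (hvL x y) (abs_nonneg _) (by positivity)
          _ = M' * ((2 / t' + 2 / t) * L) * (κ ^ (1 / p - s)) ^ (j - k) *
              ((κ ^ (s - 1 / p - γ)) ^ j * β x y ^ γ) := by
              rw [← hpw']
              ring
          _ ≤ M' * ((2 / t' + 2 / t) * L) * (κ ^ (1 / p - s)) ^ (j - k) *
              ((M * m.real R ^ (s - 1 / p - γ)) * β x y ^ γ) := by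
              gcongr
              exact (hM j R hR).2
          _ = Γ₃ * (κ ^ (1 / p - s)) ^ (j - k) * (m.real R ^ (s - 1 / p - γ) * β x y ^ γ) := by
              rw [hΓ₃]
              ring
          _ ≤ _ := by
              gcongr
              linarith
  · rw [← NNReal.coe_le_coe]
    push_cast
    rw [hΓ, hν]
    have h1 := (h.ncard_mul_le j (fun R => u k Q j R ≠ 0) _ fun R hR hne =>
      let ⟨x, hx⟩ := hv_of_u k Q j R hne
      hv_layer k Q j hkj R hR x hx).trans (hlayer k Q hQ j hkj)
    calc _ ≤ X * ((κ ^ η) ^ (j - k) * κ ^ k) / (a * κ ^ j) := (le_div_iff₀ (by positivity)).2 h1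
      _ = Γ₁ * (κ ^ (η - 1)) ^ (j - k) := by
          obtain ⟨i, rfl⟩ := Nat.exists_eq_add_of_le hkj
          rw [hΓ₁, Nat.add_sub_cancel_left, pow_add, Real.rpow_sub hκ, Real.rpow_one, div_pow]
          field_simp
      _ ≤ _ := by
          gcongr
          linarith
  · refine le_trans ?_ hΓ1
    rw [Nat.cast_le_one, Set.ncard_le_one ((P k).finite_toSet.subset fun Q hQ => hQ.1)]
    rintro Q ⟨hQ, hQu⟩ W ⟨hW, hWu⟩
    by_contra hne
    -- A cell `R` of positive measure cannot lie in two essentially disjoint cells of level `k`.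
    obtain ⟨x, hx⟩ := hv_of_u k Q j R hQu
    obtain ⟨y, hy⟩ := hv_of_u k W j R hWu
    have h1 : m R = 0 := measure_mono_null (Set.subset_inter (hv_sub k Q j R hR x hx)
      (hv_sub k W j R hR y hy)) (h.aedisjoint k Q hQ W hW hne)
    have h2 := h.measureReal_pos hR
    rw [measureReal_def, h1, ENNReal.toReal_zero] at h2
    exact lt_irrefl _ h2
  · refine (eLpNorm_le_of_bound_of_support hp (c := m.real Q ^ (s - 1 / p)) (by positivity)
      (Filter.Eventually.of_forall (hS_supp k Q hQ N hkN))).trans ?_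
    have h2 : (Γ : ℝ≥0∞) * (θ : ℝ≥0∞) ^ N =
        ENNReal.ofReal ((1 + Γ₁ + Γ₂ + Γ₃ + Γ₄) * (κ ^ s) ^ N) := by
      rw [ENNReal.ofReal_mul (by positivity), ENNReal.ofReal_pow (by positivity), ← hθ,
        ← hΓ, ENNReal.ofReal_coe_nnreal, ENNReal.ofReal_coe_nnreal]
    rw [h2]
    refine ENNReal.ofReal_le_ofReal ?_
    -- The left side is `κ ^ (s k + (η / p) (N - k))`, and `s ≤ η / p`.
    have h3 : (κ ^ (s - 1 / p)) ^ k * (((κ ^ η) ^ (N - k)) ^ (1 / p) * (κ ^ k) ^ (1 / p)) ≤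
        (κ ^ s) ^ N := by
      obtain ⟨i, rfl⟩ := Nat.exists_eq_add_of_le hkN
      rw [Nat.add_sub_cancel_left, ← Real.rpow_pow_comm hκ.le,
        ← Real.rpow_pow_comm (by positivity), ← Real.rpow_mul hκ.le, mul_left_comm, ← mul_pow,
        ← Real.rpow_add hκ, sub_add_cancel, mul_comm, pow_add]
      have h4 : s ≤ η * (1 / p) := by
        rw [mul_one_div, le_div_iff₀ hp0]
        exact hη.le
      gcongr ?_ * ?_ ^ i
      exact Real.rpow_le_rpow_of_exponent_ge hκ hκ1 h4
    calc _ ≤ M' * (κ ^ (s - 1 / p)) ^ k * (X * ((κ ^ η) ^ (N - k) * κ ^ k)) ^ (1 / p) := by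
          gcongr
          · exact (hM' k Q hQ).1
          · exact hlayer k Q hQ N hkN
      _ = Γ₄ * ((κ ^ (s - 1 / p)) ^ k *
          (((κ ^ η) ^ (N - k)) ^ (1 / p) * (κ ^ k) ^ (1 / p))) := by
          rw [Real.mul_rpow hX.le (by positivity), Real.mul_rpow (by positivity) (by positivity),
            hΓ₄]
          ring
      _ ≤ Γ₄ * (κ ^ s) ^ N := by gcongr
      _ ≤ _ := by
          gcongr
          linarith
  · filter_upwards [h.ae_existsUnique] with x hx
    refine le_trans ?_ hΓ1
    rw [Nat.cast_le_one, Set.ncard_le_one ((P k).finite_toSet.subset fun Q hQ => hQ.1)]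
    rintro Q ⟨hQ, hQu⟩ W ⟨hW, hWu⟩
    exact (hx k).unique ⟨hQ, ((hS_supp k Q hQ N hkN x).2 hQu).1⟩
      ⟨hW, ((hS_supp k W hW N hkN x).2 hWu).1⟩

end IsRegularGrid

/-! ### Equivalence of the two spaces and norms -/

theorem IsAtomicSum.congr {I : Type*} [MeasurableSpace I] {m : Measure I} {P : ℕ → Finset (Set I)}
    {p : ℝ} {a a' : ℕ → Set I → I → ℂ} {c c' : ℕ → Set I → ℂ} {f : I → ℂ}
    (h : IsAtomicSum m P p a c f)
    (hac : ∀ k, ∀ Q ∈ P k, ∀ x, c k Q * a k Q x = c' k Q * a' k Q x) :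
    IsAtomicSum m P p a' c' f := by
  have e : ∀ k x, ∑ Q ∈ P k, c k Q * a k Q x = ∑ Q ∈ P k, c' k Q * a' k Q x :=
    fun k x => Finset.sum_congr rfl fun Q hQ => hac k Q hQ x
  unfold IsAtomicSum at h ⊢
  simpa only [e] using h

section Equivalence

variable {I : Type*} [TopologicalSpace I] [MeasurableSpace I] [BorelSpace I] {β d : I → I → ℝ}
    {m : Measure I} [IsFiniteMeasure m] {P : ℕ → Finset (Set I)} {z : ℕ → Set I → I}
    {A γ L κ D a b Λ B η C₂ s p : ℝ} {q : ℝ≥0∞}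

theorem IsRegularGrid.exists_souzaRep_of_hlyRep (h : IsRegularGrid β d m P z A γ L κ D a b Λ B η C₂)
    (hp : 1 ≤ p) (hq : 1 ≤ q) (hs : 0 < s) (hsγ : s < γ) :
    ∃ K : ℝ≥0, 0 < K ∧ ∀ f, AEStronglyMeasurable f m → ∀ g c,
      IsHLYRep β m P z A C₂ κ γ s p q g c f →
        ∃ c', IsSouzaRep m P s p q c' f ∧ coeffNorm P p q c' ≤ K * coeffNorm P p q c := by
  have hκ := h.κ_pos
  have hp0 : 0 < p := by linarith
  have hA : 0 < A := zero_lt_one.trans_le h.one_le_A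
  have hC₂ := h.C₂_pos
  obtain ⟨μ, hμ⟩ : ∃ μ : ℝ≥0, (μ : ℝ) = κ ^ (γ + 1 / p - s) := ⟨⟨_, by positivity⟩, rfl⟩
  obtain ⟨ν, hν⟩ : ∃ ν : ℝ≥0, (ν : ℝ) = κ⁻¹ := ⟨⟨_, by positivity⟩, rfl⟩
  obtain ⟨θ, hθ⟩ : ∃ θ : ℝ≥0, (θ : ℝ) = κ ^ s := ⟨⟨_, by positivity⟩, rfl⟩
  have hθ1 : θ < 1 := by
    rw [← NNReal.coe_lt_coe, hθ]
    exact Real.rpow_lt_one hκ.le h.κ_lt_one hs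
  have hμν : (μ : ℝ) ^ p * ν < 1 := by
    rw [hμ, hν, ← Real.rpow_mul hκ.le, ← Real.rpow_neg_one, ← Real.rpow_add hκ]
    refine Real.rpow_lt_one hκ.le h.κ_lt_one ?_
    have : (γ + 1 / p - s) * p + -1 = (γ - s) * p := by
      field_simp
      ring
    rw [this]
    exact mul_pos (by linarith) hp0
  obtain ⟨Γ, hΓ, htr⟩ := h.exists_transfer_souza hp hsγ (R := 3 * A * C₂) (by positivity) hμ hν hθ
  obtain ⟨K, hK, hrep⟩ := IsAtomicTransfer.exists_rep (m := m) (P := P)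
    (isAtomGauge_isSouzaMultiple m s p) hp hq hΓ hθ1 hμν
  refine ⟨K, hK, fun f hf g c ⟨hg, hsum, hc⟩ => ?_⟩
  obtain ⟨S, u, hSu⟩ := htr g hg
  obtain ⟨e, U, hU, hUsum, hUc⟩ := hrep g S u c f hSu hf hsum hc
  choose! c' hc' hUc' using hU
  have hle : coeffNorm P p q c' ≤ K * coeffNorm P p q c := by
    refine (coeffNorm_mono P hp q fun k Q hQ => ?_).trans hUc
    rw [Complex.norm_real, Real.norm_of_nonneg (NNReal.coe_nonneg _)]
    exact hc' k Q hQ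
  refine ⟨c', ⟨hUsum.congr fun k Q hQ x => ?_, hle.trans_lt ?_⟩, hle⟩
  · rw [hUc' k Q hQ]
    simp
  · exact ENNReal.mul_lt_top ENNReal.coe_lt_top hc

theorem IsRegularGrid.exists_hlyRep_of_souzaRep (h : IsRegularGrid β d m P z A γ L κ D a b Λ B η C₂)
    (hp : 1 ≤ p) (hq : 1 ≤ q) (hs : 0 < s) (hη : s * p < η) :
    ∃ K : ℝ≥0, 0 < K ∧ ∀ f, AEStronglyMeasurable f m → ∀ c, IsSouzaRep m P s p q c f →
      ∃ g c', IsHLYRep β m P z A C₂ κ γ s p q g c' f ∧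
        coeffNorm P p q c' ≤ K * coeffNorm P p q c := by
  have hκ := h.κ_pos
  have hp0 : 0 < p := by linarith
  obtain ⟨μ, hμ⟩ : ∃ μ : ℝ≥0, (μ : ℝ) = κ ^ (1 / p - s) := ⟨⟨_, by positivity⟩, rfl⟩
  obtain ⟨ν, hν⟩ : ∃ ν : ℝ≥0, (ν : ℝ) = κ ^ (η - 1) := ⟨⟨_, by positivity⟩, rfl⟩
  obtain ⟨θ, hθ⟩ : ∃ θ : ℝ≥0, (θ : ℝ) = κ ^ s := ⟨⟨_, by positivity⟩, rfl⟩
  have hθ1 : θ < 1 := by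
    rw [← NNReal.coe_lt_coe, hθ]
    exact Real.rpow_lt_one hκ.le h.κ_lt_one hs
  have hμν : (μ : ℝ) ^ p * ν < 1 := by
    rw [hμ, hν, ← Real.rpow_mul hκ.le, ← Real.rpow_add hκ]
    refine Real.rpow_lt_one hκ.le h.κ_lt_one ?_
    have : (1 / p - s) * p + (η - 1) = η - s * p := by
      field_simp
      ring
    rw [this]
    linarith
  obtain ⟨Γ, hΓ, S, u, hSu⟩ := h.exists_transfer_block hp hη hμ hν hθ
  obtain ⟨K, hK, hrep⟩ := IsAtomicTransfer.exists_rep (m := m) (P := P)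
    (isAtomGauge_isBlockMultiple β m γ s p z fun k => 3 * A * C₂ * κ ^ k) hp hq hΓ hθ1 hμν
  refine ⟨K, hK, fun f hf c ⟨hsum, hc⟩ => ?_⟩
  obtain ⟨e, U, hU, hUsum, hUc⟩ := hrep _ S u c f hSu hf hsum hc
  have hblock := fun j R hR => (hU j R hR).exists_block h.nonneg
  choose! g hg hUg using hblock
  refine ⟨g, _, ⟨hg, hUsum.congr fun k Q hQ x => ?_, hUc.trans_lt ?_⟩, hUc⟩
  · rw [hUg k Q hQ]
    simp
  · exact ENNReal.mul_lt_top ENNReal.coe_lt_top hc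

end Equivalence

theorem mainTheorem2 {I : Type*} [TopologicalSpace I] [CompactSpace I] [MeasurableSpace I]
    [BorelSpace I] (ρ : I → I → ℝ) (m : Measure I) [IsProbabilityMeasure m]
    (hρ : IsHomogeneousSpace ρ m) (hatom : ∀ x, m {x} = 0)
    (A : ℝ) (hA : IsQuasiTriangleConst (msDist ρ m) A)
    (γ : ℝ) (hγ : IsMetricExponent (msDist ρ m) γ)
    (P : ℕ → Finset (Set I)) (hP : IsGoodGrid m P)
    (z : ℕ → Set I → I) (η c₁ C₂ c₃ C₄ κ : ℝ)
    (hcells : HasRegularCells (msDist ρ m) m P z η c₁ C₂ c₃ C₄ κ)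
    (s p : ℝ) (q : ℝ≥0∞) (hp : 1 ≤ p) (hq : 1 ≤ q)
    (hs : 0 < s) (hsp : s < 1 / p) (hsγ : s < γ) (hη : s * p < η) :
    hlyBesov (msDist ρ m) m P z A C₂ κ γ s p q = souzaBesov m P s p q ∧
    ∃ C : ℝ≥0, 0 < C ∧ ∀ f ∈ souzaBesov m P s p q,
      hlyBesovNorm (msDist ρ m) m P z A C₂ κ γ s p q f ≤ C * souzaBesovNorm m P s p q f ∧
      souzaBesovNorm m P s p q f ≤ C * hlyBesovNorm (msDist ρ m) m P z A C₂ κ γ s p q f := by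
  have hη0 : 0 ≤ η := le_trans (by positivity) hη.le
  obtain ⟨L, D, a, b, Λ, B, h⟩ := hρ.exists_isRegularGrid hatom hA hγ hP hcells hη0
  obtain ⟨K, hK, hsouza⟩ := h.exists_souzaRep_of_hlyRep hp hq hs hsγ
  obtain ⟨K', hK', hhly⟩ := h.exists_hlyRep_of_souzaRep hp hq hs hη
  -- Division by the constant makes it possible to compare with each representation before taking
  -- the infimum.
  have hmul : ∀ {K : ℝ≥0} {x y : ℝ≥0∞}, 0 < K → x / (K : ℝ≥0∞) ≤ y → x ≤ K * y := by
    intro K x y hK hxy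
    rwa [ENNReal.div_le_iff_le_mul (Or.inl (by exact_mod_cast hK.ne'))
      (Or.inl ENNReal.coe_ne_top), mul_comm] at hxy
  refine ⟨?_, max K K', lt_max_of_lt_left hK, fun f hf => ⟨?_, ?_⟩⟩
  · ext f
    constructor
    · rintro ⟨hf, g, c, hc⟩
      obtain ⟨c', hc', -⟩ := hsouza f hf.aestronglyMeasurable g c hc
      exact ⟨hf, c', hc'⟩
    · rintro ⟨hf, c, hc⟩
      obtain ⟨g, c', hc', -⟩ := hhly f hf.aestronglyMeasurable c hc
      exact ⟨hf, g, c', hc'⟩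
  · have h1 : hlyBesovNorm (msDist ρ m) m P z A C₂ κ γ s p q f ≤
        K' * souzaBesovNorm m P s p q f := by
      refine hmul hK' (le_iInf₂ fun c hc => ENNReal.div_le_of_le_mul' ?_)
      obtain ⟨g, c', hc', hle⟩ := hhly f hf.1.aestronglyMeasurable c hc
      exact (iInf_le_of_le g (iInf₂_le c' hc')).trans hle
    refine h1.trans ?_
    gcongr
    exact le_max_right _ _
  · have h1 : souzaBesovNorm m P s p q f ≤
        K * hlyBesovNorm (msDist ρ m) m P z A C₂ κ γ s p q f := by
      refine hmul hK (le_iInf fun g => le_iInf₂ fun c hc => ENNReal.div_le_of_le_mul' ?_)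
      obtain ⟨c', hc', hle⟩ := hsouza f hf.1.aestronglyMeasurable g c hc
      exact (iInf₂_le c' hc').trans hle
    refine h1.trans ?_
    gcongr
    exact le_max_left _ _
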